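/- Let $f=\sum_{i=0}^n a_i x^i\in\mathbb{Z}[x]$ be a polynomial of degree $n$ that is square-free (over $\mathbb{Q}$, i.e. without multiple complex roots), let $\tau\in\mathbb{N}$ be such that $|a_i|<2^\tau$ for all $i$, and assume $n\tau\ge 2$ (so that $\log n+\log\tau>0$). For an open interval $I=(a,b)$ of width $w(I)=b-a$, let $\operatorname{var}(f,I)$ be the number of sign variations (zeros ignored) in the coefficient sequence of $f_I(x)=(x+1)^n f\left(\frac{ax+b}{x+1}\right)$. The algorithm $\textsc{Dsc}^2$ processes pairs $(I,N_I)$, starting with $(I_0,4)$, where $I_0=(-2^{\tau+1},2^{\tau+1})$. For a pair $(I,N_I)$ with $I=(a,b)$, let $v=\operatorname{var}(f,I)$. (1) If $v\le 1$, then $(I,N_I)$ is a leaf. (2) Otherwise, if $B_1=(a,a+\frac{w(I)}{N_I})$ or $B_2=(b-\frac{w(I)}{N_I},b)$ has $\operatorname{var}(f,B_i)=v$, then the only child is $(B_i,N_I^2)$. (3) Otherwise, let $\lambda_1=a-v\frac{f(a)}{f'(a)}$, $\lambda_2=b-v\frac{f(b)}{f'(b)}$ and, for $i=1,2$, $k_i=\min(\max(\lfloor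 4N_I\frac{\lambda_i-a}{b-a}\rfloor,2),4N_I-2)$ and $I_i'=(a+(k_i-2)\frac{w(I)}{4N_I},a+(k_i+2)\frac{w(I)}{4N_I})$ (a candidate $I_i'$ whose defining quotient has denominator $0$ is disregarded). If $\operatorname{var}(f,I_i')=v$ for some $i$, then, for the smallest such $i$, the only child is $(I_i',N_I^2)$. (4) Otherwise, the children are $((a,\frac{a+b}{2}),\max(4,\sqrt{N_I}))$ and $((\frac{a+b}{2},b),\max(4,\sqrt{N_I}))$. Then $\textsc{Dsc}^2$ terminates on $f$, and the number $|T_{\textsc{Dsc}^2}|$ of nodes of its recursion tree satisfies $$|T_{\textsc{Dsc}^2}|\le C\cdot\max(1,\operatorname{var}(f,I_0))\cdot(\log n+\log\tau)\quad\text{and}\quad |T_{\textsc{Dsc}^2}|\le C\cdot n\cdot(\log n+\log\tau)$$ with an absolute constant $C>0$, independent of $n$, $\tau$ and $f$. -/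

import Mathlib

namespace DscSq

/-- The polynomial `f_I(x) = (x + 1)^n * f((a x + b) / (x + 1))` for `I = (a, b)` and `n = deg f`,
written out as `∑ i, f_i * (a x + b)^i * (x + 1)^(n - i)`. -/
noncomputable def mobius (f : Polynomial ℤ) (a b : ℚ) : Polynomial ℚ :=
  ∑ i ∈ Finset.range (f.natDegree + 1),
    Polynomial.C (f.coeff i : ℚ) * (Polynomial.C a * Polynomial.X + Polynomial.C b) ^ i *
      (Polynomial.X + 1) ^ (f.natDegree - i)

/-- `var(f, I)` for `I = (a, b)`: the number of sign variations in the coefficient sequence of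
`f_I`, zero coefficients being ignored. -/
noncomputable def var (f : Polynomial ℤ) (a b : ℚ) : ℕ :=
  (mobius f a b).signVariations

/-- An active pair `(I, N_I)`: an open interval `I = (a, b)` together with the integer `N_I`. -/
structure Active where
  a : ℚ
  b : ℚ
  N : ℕ

/-- The width `w(I)`. -/
def Active.width (p : Active) : ℚ := p.b - p.a

/-- `var(f, I)` for an active pair `(I, N_I)`. -/
noncomputable def Active.var (f : Polynomial ℤ) (p : Active) : ℕ := DscSq.var f p.a p.b

/-- `(B_1, N_I^2)`, where `B_1` is the leftmost subinterval of `I` of width `w(I) / N_I`. -/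
def Active.leftmost (p : Active) : Active := ⟨p.a, p.a + p.width / p.N, p.N ^ 2⟩

/-- `(B_2, N_I^2)`, where `B_2` is the rightmost subinterval of `I` of width `w(I) / N_I`. -/
def Active.rightmost (p : Active) : Active := ⟨p.b - p.width / p.N, p.b, p.N ^ 2⟩

/-- The Newton step `t - v * f(t) / f'(t)` for a `v`-fold root. If `f'(t) = 0`, its value is `t`;
for `t` an endpoint of `I` the candidate interval built from it is then `B_1` or `B_2`. -/
noncomputable def newton (f : Polynomial ℤ) (v : ℕ) (t : ℚ) : ℚ :=
  t - v * (Polynomial.aeval t f / Polynomial.aeval t (Polynomial.derivative f))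

/-- The index `k = min (max ⌊4 N_I (l - a) / (b - a)⌋ 2) (4 N_I - 2)` of a subdivision point
`a + k * w(I) / (4 N_I)` near `l`. -/
def Active.gridIndex (p : Active) (l : ℚ) : ℤ :=
  min (max ⌊4 * (p.N : ℚ) * ((l - p.a) / (p.b - p.a))⌋ 2) (4 * (p.N : ℤ) - 2)

/-- `(I', N_I^2)`, where `I'` is the subinterval of `I` of width `w(I) / N_I` centered at the
subdivision point of index `gridIndex l`. -/
def Active.newtonInterval (p : Active) (l : ℚ) : Active :=
  ⟨p.a + ((p.gridIndex l : ℚ) - 2) * (p.width / (4 * p.N)),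
   p.a + ((p.gridIndex l : ℚ) + 2) * (p.width / (4 * p.N)), p.N ^ 2⟩

/-- The left half of `I`, with `max(4, √N_I)`; all `N_I` that occur are of the form `2^(2^k)`,
`1 ≤ k`, so that the square root is exact. -/
def Active.leftHalf (p : Active) : Active := ⟨p.a, (p.a + p.b) / 2, max 4 p.N.sqrt⟩

/-- The right half of `I`, with `max(4, √N_I)`. -/
def Active.rightHalf (p : Active) : Active := ⟨(p.a + p.b) / 2, p.b, max 4 p.N.sqrt⟩

/-- One iteration of the algorithm Dsc²: the active pairs that replace `(I, N_I)`. -/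
noncomputable def children (f : Polynomial ℤ) (p : Active) : List Active :=
  let v := p.var f
  let I₁ := p.newtonInterval (newton f v p.a)
  let I₂ := p.newtonInterval (newton f v p.b)
  if v ≤ 1 then []
  else if p.leftmost.var f = v then [p.leftmost]
  else if p.rightmost.var f = v then [p.rightmost]
  else if I₁.var f = v then [I₁]
  else if I₂.var f = v then [I₂]
  else [p.leftHalf, p.rightHalf]

/-- Finite trees with nodes labelled by active pairs in which each node has at most two
children. -/
inductive Tree where
  | leaf (p : Active) : Tree
  | keep (p : Active) (t : Tree) : Tree
  | split (p : Active) (t₁ t₂ : Tree) : Tree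

/-- The number of all nodes of a tree. -/
def Tree.size : Tree → ℕ
  | .leaf _ => 1
  | .keep _ t => t.size + 1
  | .split _ t₁ t₂ => t₁.size + t₂.size + 1

/-- `IsRecursionTree f p T`: the algorithm Dsc² for `f`, started with the active pair `p`,
terminates and `T` is its recursion tree. -/
inductive IsRecursionTree (f : Polynomial ℤ) : Active → Tree → Prop
  | leaf (p : Active) (h : children f p = []) : IsRecursionTree f p (.leaf p)
  | keep (p q : Active) (t : Tree) (h : children f p = [q]) (ht : IsRecursionTree f q t) :
      IsRecursionTree f p (.keep p t)
  | split (p q₁ q₂ : Active) (t₁ t₂ : Tree) (h : children f p = [q₁, q₂])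
      (h₁ : IsRecursionTree f q₁ t₁) (h₂ : IsRecursionTree f q₂ t₂) :
      IsRecursionTree f p (.split p t₁ t₂)

/-- The recursion tree is unique. -/
theorem IsRecursionTree.unique {f : Polynomial ℤ} {p : Active} {T : Tree}
    (h : IsRecursionTree f p T) : ∀ {T' : Tree}, IsRecursionTree f p T' → T' = T := by
  induction h with
  | leaf p h => intro T' h'; cases h' <;> simp_all
  | keep p q t h _ ih =>
    intro T' h'
    cases h' <;> simp_all
  | split p q₁ q₂ t₁ t₂ h _ _ ih₁ ih₂ =>
    intro T' h'
    cases h' <;> simp_all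

/-- The initial active pair `(I₀, 4)` with `I₀ = (-2^(τ+1), 2^(τ+1))`. -/
def initial (τ : ℕ) : Active := ⟨-2 ^ (τ + 1), 2 ^ (τ + 1), 4⟩

end DscSq

/-! Bisecting an interval splits its variation count subadditively (`var_add_var_le`), so only O(v)
bisections separate counts, where v is the initial count. It remains to bound by O(log n + log τ)
the length of a path of the tree along which the count keeps a value v ≥ 2; the siblings left behind
by such a path have count 0 and are leaves.

Geometry. `var f a b` is at least the number of roots in a thin lens about (a, b) (`card_le_var`)
and at most the number of roots within (n + 2)(b - a) of a (`var_le_card`). Both follow from a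
sector theorem in the manner of Obreshkoff (`card_roots_sector_le_signVariations`), applied to
f_I(x) and to f_I(-x). Hence two variations force two nearby roots, and `root_separation` keeps
widths above 2^(-O(n²τ)). If the interval lies deep inside an earlier one with the same count v, the
roots near the end q of the path form a cluster of exactly v roots, far from all others. The Newton
step for a v-fold root, taken from the endpoint farther from q, then lands so close to q that the
test succeeds (`exists_newtonInterval_contains`), provided that N w is small compared to the
separation and w is large compared to N n w(q).

Counting. Put L = log₂ N and W = log₂ w. A quadratic step sends (L, W) to (2L, W - L), a bisection
sends it to (max(2, L/2), W - 1). Thus L + W is invariant under quadratic steps, and a bisection at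
which 2 ≤ W - ω < L multiplies L + W - ω by at most 3/4 (`Path.fails_le_of_threshold`). As L and W
are polynomially bounded in nτ, each of the following phases has logarithmically many bisections:
the left endpoint stays fixed; the right endpoint stays fixed; the distance to both old endpoints
grows relative to w; N w drops below the separation scale; the cluster is approached. Since L is
bounded, bisections control all steps (`Path.length_le_fails`). -/

namespace DscSq
open Polynomial

/-! ### Sign changes of sequences and the de Casteljau scheme. -/

section SignChanges

set_option linter.unusedSectionVars false

variable {R : Type*} [Field R] [LinearOrder R] [IsStrictOrderedRing R]

/-- The number of sign changes in the list `l`, zeros being ignored, if the last nonzero element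
before `l` had sign `s` (`s = 0` if there was none). -/
def signChanges (s : SignType) : List R → ℕ
  | [] => 0
  | x :: l =>
    if SignType.sign x = 0 then signChanges s l
    else (if s = 0 ∨ SignType.sign x = s then 0 else 1) + signChanges (SignType.sign x) l

@[simp] theorem signChanges_nil (s : SignType) : signChanges s ([] : List R) = 0 := rfl

theorem signChanges_cons_zero (s : SignType) (l : List R) :
    signChanges s (0 :: l) = signChanges s l := by
  simp [signChanges]

theorem signChanges_cons_pos (s : SignType) {x : R} (hx : 0 < x) (l : List R) :
    signChanges s (x :: l) = (if s = -1 then 1 else 0) + signChanges 1 l := by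
  rcases s with _ | _ | _ <;> simp [signChanges, sign_pos hx]

theorem signChanges_cons_neg (s : SignType) {x : R} (hx : x < 0) (l : List R) :
    signChanges s (x :: l) = (if s = 1 then 1 else 0) + signChanges (-1) l := by
  rcases s with _ | _ | _ <;> simp [signChanges, sign_neg hx]

theorem signChanges_le_add_one (s t : SignType) (l : List R) :
    signChanges s l ≤ signChanges t l + 1 := by
  induction l generalizing s t with
  | nil => simp
  | cons x l ih =>
    rcases lt_trichotomy x 0 with hx | rfl | hx
    · rw [signChanges_cons_neg s hx, signChanges_cons_neg t hx]
      split_ifs <;> omega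
    · simpa only [signChanges_cons_zero] using ih s t
    · rw [signChanges_cons_pos s hx, signChanges_cons_pos t hx]
      split_ifs <;> omega

theorem signChanges_zero_le (s : SignType) (l : List R) :
    signChanges 0 l ≤ signChanges s l := by
  induction l generalizing s with
  | nil => simp
  | cons x l ih =>
    rcases lt_trichotomy x 0 with hx | rfl | hx
    · rw [signChanges_cons_neg 0 hx, signChanges_cons_neg s hx]
      simp
    · simpa only [signChanges_cons_zero] using ih s
    · rw [signChanges_cons_pos 0 hx, signChanges_cons_pos s hx]
      simp

theorem signChanges_le_cons (s : SignType) (x : R) (l : List R) :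
    signChanges s l ≤ signChanges s (x :: l) := by
  have h1 := signChanges_zero_le 1 l
  have h2 := signChanges_zero_le (-1) l
  have h3 := signChanges_le_add_one 1 (-1) l
  have h4 := signChanges_le_add_one (-1) 1 l
  rcases lt_trichotomy x 0 with hx | rfl | hx
  · rw [signChanges_cons_neg s hx]
    rcases s with _ | _ | _ <;> simp at * <;> omega
  · rw [signChanges_cons_zero]
  · rw [signChanges_cons_pos s hx]
    rcases s with _ | _ | _ <;> simp at * <;> omega

theorem signChanges_cons_congr (s : SignType) (x : R) {l l' : List R}
    (h : ∀ t, signChanges t l ≤ signChanges t l') :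
    signChanges s (x :: l) ≤ signChanges s (x :: l') := by
  rcases lt_trichotomy x 0 with hx | rfl | hx
  · simpa [signChanges_cons_neg s hx] using h (-1)
  · simpa [signChanges_cons_zero] using h s
  · simpa [signChanges_cons_pos s hx] using h 1

/-- Inserting a positive combination of two neighbours creates no sign change. -/
theorem signChanges_insert_comb {α β : R} (hα : 0 < α) (hβ : 0 < β) (s : SignType) (x y : R)
    (l : List R) :
    signChanges s (x :: (α * x + β * y) :: y :: l) ≤ signChanges s (x :: y :: l) := by
  -- An inserted z can cost a change only if its sign differs from the state s and y lies weakly on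
  -- the other side of 0. With s the sign of x, this is impossible for z = αx + βy.
  have aux : ∀ (s : SignType) (z : R), signChanges s (z :: y :: l) ≤ signChanges s (y :: l) ∨
      ((z < 0 ∧ s ≠ -1 ∧ 0 ≤ y) ∨ (0 < z ∧ s ≠ 1 ∧ y ≤ 0)) ∨ s = 0 := by
    intro s z
    rcases lt_trichotomy z 0 with hz | rfl | hz <;> rcases lt_trichotomy y 0 with hy | rfl | hy <;>
    rcases s with _ | _ | _ <;>
    simp [signChanges_cons_zero, *, signChanges_cons_pos, signChanges_cons_neg, le_of_lt]
  rcases lt_trichotomy x 0 with hx | rfl | hx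
  · rw [signChanges_cons_neg s hx, signChanges_cons_neg s hx]
    have hx' : α * x < 0 := mul_neg_of_pos_of_neg hα hx
    rcases aux (-1) (α * x + β * y) with h | (⟨h1, h2, h3⟩ | ⟨h1, h2, h3⟩) | h
    · omega
    · simp at h2
    · nlinarith
    · simp at h
  · simp only [signChanges_cons_zero]
    rcases lt_trichotomy y 0 with hy | rfl | hy
    · have : α * 0 + β * y < 0 := by nlinarith
      rw [signChanges_cons_neg s this, signChanges_cons_neg _ hy, signChanges_cons_neg _ hy]
      simp
    · simp [signChanges_cons_zero]
    · have : 0 < α * 0 + β * y := by nlinarith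
      rw [signChanges_cons_pos s this, signChanges_cons_pos _ hy, signChanges_cons_pos _ hy]
      simp
  · rw [signChanges_cons_pos s hx, signChanges_cons_pos s hx]
    have hx' : 0 < α * x := mul_pos hα hx
    rcases aux 1 (α * x + β * y) with h | (⟨h1, h2, h3⟩ | ⟨h1, h2, h3⟩) | h
    · omega
    · nlinarith
    · simp at h2
    · simp at h

/-- One step of the scheme of de Casteljau on a sequence. -/
def casteljau (α β : R) (u : ℕ → R) (i : ℕ) : R := α * u i + β * u (i + 1)

/-- Averages inserted between their neighbours create no change, and dropping the inner original
terms can only lose changes. The tail `l` collects the right edge of the triangle in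
`signChanges_casteljau`. -/
theorem signChanges_casteljau_step {α β : R} (hα : 0 < α) (hβ : 0 < β) (k : ℕ) (u : ℕ → R)
    (s : SignType) (l : List R) :
    signChanges s (u 0 :: ((List.range k).map (casteljau α β u) ++ u k :: l)) ≤
      signChanges s ((List.range (k + 1)).map u ++ l) := by
  induction k generalizing u s with
  | zero =>
    rcases lt_trichotomy (u 0) 0 with hx | hx | hx
    · simp [signChanges_cons_neg _ hx]
    · simp [hx, signChanges_cons_zero]
    · simp [signChanges_cons_pos _ hx]
  | succ k ih =>
    have h1 := ih (fun i => u (i + 1))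
    rw [List.range_succ_eq_map, List.range_succ_eq_map (n := k + 1)]
    simp only [List.map_cons, List.map_map, List.cons_append]
    have e1 : (casteljau α β u ∘ Nat.succ) = casteljau α β (fun i => u (i + 1)) := rfl
    have e2 : u ∘ Nat.succ = fun i => u (i + 1) := rfl
    rw [e1, e2]
    calc _ ≤ signChanges s (u 0 :: casteljau α β u 0 :: u 1 ::
          ((List.range k).map (casteljau α β (fun i => u (i + 1))) ++ u (k + 1) :: l)) :=
          signChanges_cons_congr _ _ fun t => signChanges_cons_congr _ _ fun t' =>
            signChanges_le_cons _ _ _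
      _ ≤ signChanges s (u 0 :: u 1 ::
          ((List.range k).map (casteljau α β (fun i => u (i + 1))) ++ u (k + 1) :: l)) :=
          signChanges_insert_comb hα hβ _ _ _ _
      _ ≤ _ := signChanges_cons_congr _ _ fun t => h1 t

/-- The scheme of de Casteljau splits the sign changes of a sequence between its two sides. -/
theorem signChanges_casteljau {α β : R} (hα : 0 < α) (hβ : 0 < β) (k : ℕ) (u : ℕ → R)
    (s : SignType) (l : List R) :
    signChanges s ((List.range (k + 1)).map fun r => (casteljau α β)^[r] u 0) +
      signChanges 0 (((List.range (k + 1)).map fun i => (casteljau α β)^[k - i] u i) ++ l) ≤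
      signChanges s ((List.range (k + 1)).map u ++ l) := by
  induction k generalizing u s l with
  | zero =>
    simp only [zero_add, List.range_one, List.map_cons, List.map_nil, Function.iterate_zero, id,
      Nat.sub_self, List.cons_append, List.nil_append]
    -- The apex of the triangle lies on both edges. The state 0 at the start of the right edge
    -- prevents a change at the apex from being counted twice.
    rcases lt_trichotomy (u 0) 0 with hx | hx | hx
    · simp [signChanges_cons_neg _ hx]
    · simpa [hx, signChanges_cons_zero] using signChanges_zero_le s l
    · simp [signChanges_cons_pos _ hx]
  | succ k ih =>
    -- One averaging step peels off `u 0` for the left edge and `u (k + 1)` for the right one; what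
    -- remains is the triangle of the averaged sequence.
    refine le_trans ?_ (signChanges_casteljau_step hα hβ (k + 1) u s l)
    have h := fun s => ih (casteljau α β u) s (u (k + 1) :: l)
    have e1 : ((List.range (k + 1 + 1)).map fun r => (casteljau α β)^[r] u 0) =
        u 0 :: (List.range (k + 1)).map fun r => (casteljau α β)^[r] (casteljau α β u) 0 := by
      rw [List.range_succ_eq_map]; simp [Function.comp_def]
    have e2 : ((List.range (k + 1 + 1)).map fun i => (casteljau α β)^[k + 1 - i] u i) ++ l =
        ((List.range (k + 1)).map fun i => (casteljau α β)^[k - i] (casteljau α β u) i) ++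
          u (k + 1) :: l := by
      rw [List.range_succ]
      simp only [List.map_append, List.map_cons, List.map_nil, Nat.sub_self, Function.iterate_zero,
        id, List.append_assoc, List.cons_append, List.nil_append, List.append_cancel_right_eq]
      apply List.map_congr_left
      intro i hi
      have : k + 1 - i = (k - i) + 1 := by have := List.mem_range.1 hi; omega
      rw [this, Function.iterate_succ_apply]
    rw [e1, e2]
    rcases lt_trichotomy (u 0) 0 with hx | hx | hx
    · have := h (-1)
      rw [signChanges_cons_neg _ hx, signChanges_cons_neg _ hx]; omega
    · have := h s
      rw [hx, signChanges_cons_zero, signChanges_cons_zero]; exact this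
    · have := h 1
      rw [signChanges_cons_pos _ hx, signChanges_cons_pos _ hx]; omega

theorem signChanges_map_congr {ι : Type*} (s : SignType) (l : List ι) {u v : ι → R}
    (h : ∀ i ∈ l, SignType.sign (u i) = SignType.sign (v i)) :
    signChanges s (l.map u) = signChanges s (l.map v) := by
  induction l generalizing s with
  | nil => rfl
  | cons x l ih =>
    simp only [List.map_cons, signChanges, h x (by simp)]
    rw [ih _ fun i hi => h i (by simp [hi]), ih _ fun i hi => h i (by simp [hi])]

theorem length_destutter_sign (s : SignType) (hs : s ≠ 0) (l : List R) :
    (List.destutter' (· ≠ ·) s ((l.map SignType.sign).filter (· ≠ 0))).length =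
      signChanges s l + 1 := by
  induction l generalizing s with
  | nil => simp
  | cons x l ih =>
    by_cases hx : SignType.sign x = 0
    · have := ih s hs
      simpa [hx, signChanges] using this
    · rw [List.map_cons, List.filter_cons_of_pos (by simpa using hx), signChanges, if_neg hx,
        List.destutter']
      by_cases hsx : s = SignType.sign x
      · have := ih s hs
        rw [if_neg (by simpa using hsx), if_pos (Or.inr hsx.symm), this, ← hsx]; omega
      · rw [if_pos hsx, if_neg (by tauto), List.length_cons, ih _ hx]; omega

theorem signVariations_eq_signChanges (p : R[X]) :
    p.signVariations = signChanges 0 p.coeffList := by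
  rw [signVariations]
  generalize p.coeffList = l
  induction l with
  | nil => simp
  | cons x l ih =>
    by_cases hx : SignType.sign x = 0
    · simpa [hx, signChanges] using ih
    · rw [List.map_cons, List.filter_cons_of_pos (by simpa using hx), signChanges, if_neg hx]
      simp only [List.destutter]
      rw [length_destutter_sign _ hx]; simp

/-- Leading zeros are harmless. This is needed because f_I can have degree less than n. -/
theorem signVariations_eq_of_natDegree_le (p : R[X]) {n : ℕ} (hn : p.natDegree ≤ n) :
    p.signVariations = signChanges 0 ((List.range (n + 1)).map fun j => p.coeff (n - j)) := by
  induction n with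
  | zero =>
    rw [signVariations_eq_signChanges]
    by_cases hp : p = 0
    · simp [hp, signChanges_cons_zero]
    · simp [coeffList, withBotSucc_degree_eq_natDegree_add_one hp, Nat.le_zero.1 hn]
  | succ n ih =>
    by_cases h : p.natDegree ≤ n
    · rw [ih h, List.range_succ_eq_map (n := n + 1)]
      simp only [List.map_cons, List.map_map, Nat.sub_zero,
        coeff_eq_zero_of_natDegree_lt (Nat.lt_succ_of_le h), signChanges_cons_zero]
      congr 2
      funext j
      simp
    · have hd : p.natDegree = n + 1 := by omega
      have hp : p ≠ 0 := by rintro rfl; simp at hd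
      rw [signVariations_eq_signChanges, coeffList, withBotSucc_degree_eq_natDegree_add_one hp, hd,
        List.map_reverse]
      congr 1
      apply List.ext_getElem
      · simp
      · intro i h1 h2
        simp only [List.getElem_reverse, List.getElem_map, List.getElem_range, List.length_map,
          List.length_range]
        congr 1

end SignChanges
theorem signVariations_congr {R S : Type*} [Field R] [LinearOrder R] [Field S] [LinearOrder S]
    {p : R[X]} {q : S[X]} (h : ∀ i, SignType.sign (p.coeff i) = SignType.sign (q.coeff i)) :
    p.signVariations = q.signVariations := by
  have hs : p.support = q.support := by
    ext i
    rw [mem_support_iff, mem_support_iff, ← sign_ne_zero, h i, sign_ne_zero]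
  have hd : p.degree = q.degree := by rw [degree, degree, hs]
  have : p.coeffList.map SignType.sign = q.coeffList.map SignType.sign := by
    simp only [coeffList, hd, List.map_map]
    exact List.map_congr_left fun i _ => h i
  simp only [signVariations, this]

/-! ### Bernstein forms. -/

/-- The form `∑ j, (k choose j) * u j * x ^ (k - j) * y ^ j`, by recursion on `k`. -/
def bernstein {A : Type*} [CommRing A] [Algebra ℚ A] : ℕ → (ℕ → ℚ) → A → A → A
  | 0, u, _, _ => algebraMap ℚ A (u 0)
  | k + 1, u, x, y => x * bernstein k u x y + y * bernstein k (fun i => u (i + 1)) x y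

section Bernstein

variable {A : Type*} [CommRing A] [Algebra ℚ A]

theorem bernstein_comb (α β : ℚ) (k : ℕ) (u : ℕ → ℚ) (x y : A) :
    bernstein k (casteljau α β u) x y = algebraMap ℚ A α * bernstein k u x y +
      algebraMap ℚ A β * bernstein k (fun i => u (i + 1)) x y := by
  induction k generalizing u with
  | zero => simp [bernstein, casteljau]
  | succ k ih =>
    have e : (fun i => casteljau α β u (i + 1)) = casteljau α β (fun i => u (i + 1)) := rfl
    simp only [bernstein, e, ih]
    ring

/-- The substitution that restricts to the left subinterval yields the left edge of the triangle of
iterated averages; `bernstein_right` yields the right edge. -/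
theorem bernstein_left (α β : ℚ) (k : ℕ) (u : ℕ → ℚ) (x y : A) :
    bernstein k u (x + algebraMap ℚ A α * y) (algebraMap ℚ A β * y) =
      bernstein k (fun r => (casteljau α β)^[r] u 0) x y := by
  induction k generalizing u with
  | zero => simp [bernstein]
  | succ k ih =>
    have h := ih (casteljau α β u)
    rw [bernstein_comb] at h
    simp only [bernstein, Function.iterate_succ_apply, ← h, ← ih u]
    ring

theorem bernstein_congr {k : ℕ} {u v : ℕ → ℚ} (h : ∀ i ≤ k, u i = v i) (x y : A) :
    bernstein k u x y = bernstein k v x y := by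
  induction k generalizing u v with
  | zero => simp [bernstein, h 0]
  | succ k ih =>
    simp only [bernstein]
    rw [ih fun i hi => h i (by omega), ih (u := fun i => u (i + 1)) fun i hi => h (i + 1) (by omega)]

theorem casteljau_iterate_shift (α β : ℚ) (r : ℕ) (u : ℕ → ℚ) (i : ℕ) :
    (casteljau α β)^[r] (fun i => u (i + 1)) i = (casteljau α β)^[r] u (i + 1) := by
  induction r generalizing u with
  | zero => rfl
  | succ r ih =>
    rw [Function.iterate_succ_apply, Function.iterate_succ_apply, ← ih (casteljau α β u)]
    rfl

theorem bernstein_right (α β : ℚ) (k : ℕ) (u : ℕ → ℚ) (x y : A) :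
    bernstein k u (algebraMap ℚ A α * x) (algebraMap ℚ A β * x + y) =
      bernstein k (fun i => (casteljau α β)^[k - i] u i) x y := by
  induction k generalizing u with
  | zero => simp [bernstein]
  | succ k ih =>
    have h := ih (casteljau α β u)
    rw [bernstein_comb] at h
    have e1 : bernstein k (fun i => (casteljau α β)^[k + 1 - i] u i) x y =
        bernstein k (fun i => (casteljau α β)^[k - i] (casteljau α β u) i) x y := by
      apply bernstein_congr
      intro i hi
      rw [show k + 1 - i = k - i + 1 by omega, Function.iterate_succ_apply]
    have e2 := ih (fun i => u (i + 1))
    simp only [casteljau_iterate_shift] at e2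
    simp only [bernstein, e1, ← h, Nat.add_sub_add_right, ← e2]
    ring

theorem bernstein_smul (k : ℕ) (u : ℕ → ℚ) (c x y : A) :
    bernstein k u (c * x) (c * y) = c ^ k * bernstein k u x y := by
  induction k generalizing u with
  | zero => simp [bernstein]
  | succ k ih => simp only [bernstein, ih]; ring

end Bernstein

theorem natDegree_bernstein_le (k : ℕ) (u : ℕ → ℚ) :
    (bernstein k u (X : ℚ[X]) 1).natDegree ≤ k := by
  induction k generalizing u with
  | zero => simp [bernstein]
  | succ k ih =>
    simp only [bernstein, one_mul]
    refine (natDegree_add_le _ _).trans (max_le ?_ ((ih _).trans (by omega)))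
    exact natDegree_mul_le.trans (by rw [natDegree_X]; have := ih u; omega)

theorem coeff_bernstein (k : ℕ) (u : ℕ → ℚ) (j : ℕ) (hj : j ≤ k) :
    (bernstein k u (X : ℚ[X]) 1).coeff (k - j) = k.choose j * u j := by
  induction k generalizing u j with
  | zero => obtain rfl : j = 0 := by omega
            simp [bernstein]
  | succ k ih =>
    simp only [bernstein, one_mul, coeff_add]
    rcases j with _ | j
    · have h := ih u 0 (by omega)
      rw [Nat.sub_zero] at h ⊢
      rw [coeff_X_mul, h, coeff_eq_zero_of_natDegree_lt (lt_of_le_of_lt (natDegree_bernstein_le k _) (by omega))]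
      simp
    · have h2 := ih (fun i => u (i + 1)) j (by omega)
      rw [Nat.add_sub_add_right, h2, Nat.choose_succ_succ]
      rcases Nat.lt_or_ge j k with hk | hk
      · have h1 := ih u (j + 1) hk
        rw [show k - j = (k - (j + 1)) + 1 by omega, coeff_X_mul, h1]
        push_cast; ring
      · obtain rfl : j = k := by omega
        simp

theorem exists_bernstein (n : ℕ) (p : ℚ[X]) (hp : p.natDegree ≤ n) :
    ∃ u, p = bernstein n u X 1 := by
  refine ⟨fun j => p.coeff (n - j) / n.choose j, ?_⟩
  ext i
  rcases Nat.lt_or_ge n i with hi | hi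
  · rw [coeff_eq_zero_of_natDegree_lt (hp.trans_lt hi),
      coeff_eq_zero_of_natDegree_lt ((natDegree_bernstein_le _ _).trans_lt hi)]
  · have h := coeff_bernstein n (fun j => p.coeff (n - j) / n.choose j) (n - i) (by omega)
    rw [Nat.sub_sub_self hi] at h
    rw [h, mul_div_cancel₀]
    exact_mod_cast (Nat.choose_pos (Nat.sub_le n i)).ne'

theorem signVariations_bernstein (n : ℕ) (u : ℕ → ℚ) :
    (bernstein n u (X : ℚ[X]) 1).signVariations =
      signChanges 0 ((List.range (n + 1)).map u) := by
  rw [signVariations_eq_of_natDegree_le _ (natDegree_bernstein_le n u)]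
  apply signChanges_map_congr
  intro j hj
  have hj := List.mem_range.1 hj
  rw [coeff_bernstein n u j (by omega), sign_mul, sign_pos, one_mul]
  exact_mod_cast Nat.choose_pos (by omega)

/-! ### Möbius transforms and subadditivity of the variation count. -/

theorem natDegree_mobius_le (f : ℤ[X]) (a b : ℚ) : (mobius f a b).natDegree ≤ f.natDegree := by
  apply natDegree_sum_le_of_forall_le
  intro i hi
  have hi := Finset.mem_range.1 hi
  refine natDegree_mul_le.trans ?_
  have h1 : ((C a * X + C b : ℚ[X]) ^ i).natDegree ≤ i :=
    natDegree_pow_le.trans (by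
      have : (C a * X + C b : ℚ[X]).natDegree ≤ 1 := natDegree_linear_le
      nlinarith)
  have h2 : ((X + 1 : ℚ[X]) ^ (f.natDegree - i)).natDegree ≤ f.natDegree - i :=
    natDegree_pow_le.trans (by
      have : (X + 1 : ℚ[X]).natDegree ≤ 1 := by simpa using (natDegree_X_add_C (1 : ℚ)).le
      nlinarith)
  have h3 : (C (f.coeff i : ℚ) * (C a * X + C b) ^ i).natDegree ≤ i :=
    (natDegree_C_mul_le _ _).trans h1
  omega

theorem eval_mobius (f : ℤ[X]) (a b x : ℚ) : (mobius f a b).eval x =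
    ∑ i ∈ Finset.range (f.natDegree + 1),
      (f.coeff i : ℚ) * (a * x + b) ^ i * (x + 1) ^ (f.natDegree - i) := by
  simp [mobius, eval_finsetSum]

theorem eval_mobius_homogeneous (f : ℤ[X]) (a b : ℚ) {x y : ℚ} (hy : y ≠ 0) :
    y ^ f.natDegree * (mobius f a b).eval (x / y) =
    ∑ i ∈ Finset.range (f.natDegree + 1),
      (f.coeff i : ℚ) * (a * x + b * y) ^ i * (x + y) ^ (f.natDegree - i) := by
  rw [eval_mobius, Finset.mul_sum]
  apply Finset.sum_congr rfl
  intro i hi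
  have hi := Finset.mem_range.1 hi
  have e1 : a * (x / y) + b = (a * x + b * y) / y := by field_simp
  have e2 : x / y + 1 = (x + y) / y := by field_simp
  have e3 : y ^ f.natDegree = y ^ i * y ^ (f.natDegree - i) := by
    rw [← pow_add]; congr 1; omega
  rw [e1, e2, e3, div_pow, div_pow]
  field_simp

theorem eval_bernstein (k : ℕ) (u : ℕ → ℚ) (p q : ℚ[X]) (x : ℚ) :
    (bernstein k u p q).eval x = bernstein k u (p.eval x) (q.eval x) := by
  induction k generalizing u with
  | zero => simp [bernstein]
  | succ k ih => simp [bernstein, ih]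

/-- The homogenisation of f_I is the sum of f_i (ax + by)^i (x + y)^(n - i). Passing to another
interval is therefore a linear substitution of (p, q) for (x, y), determined by the two identities
assumed. Positive x suffice for the comparison and avoid the zeros of q. -/
theorem mobius_eq_bernstein (f : ℤ[X]) {a b : ℚ} {u : ℕ → ℚ}
    (hu : mobius f a b = bernstein f.natDegree u X 1) (a' b' : ℚ) (p q : ℚ[X])
    (hq : ∀ x : ℚ, 0 < x → q.eval x ≠ 0)
    (h1 : ∀ x : ℚ, a * p.eval x + b * q.eval x = a' * x + b')
    (h2 : ∀ x : ℚ, p.eval x + q.eval x = x + 1) :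
    mobius f a' b' = bernstein f.natDegree u p q := by
  apply eq_of_infinite_eval_eq
  refine (Set.Ioi_infinite (0 : ℚ)).mono ?_
  intro x hx
  have hx := hq x hx
  have h := eval_mobius_homogeneous f a b (x := p.eval x) hx
  rw [hu, eval_bernstein, eval_X, eval_one, ← bernstein_smul, mul_one,
    mul_div_cancel₀ _ hx] at h
  rw [Set.mem_ofPred_eq, eval_mobius, eval_bernstein, h]
  simp only [h1, h2]

/-- Subadditivity of the number of sign variations. -/
theorem var_add_var_le (f : ℤ[X]) {a m b : ℚ} (ham : a < m) (hmb : m < b) :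
    var f a m + var f m b ≤ var f a b := by
  obtain ⟨u, hu⟩ := exists_bernstein _ _ (natDegree_mobius_le f a b)
  have hab : 0 < b - a := by linarith
  set α := (b - m) / (b - a) with hα
  set β := (m - a) / (b - a) with hβ
  have hα0 : 0 < α := div_pos (by linarith) hab
  have hβ0 : 0 < β := div_pos (by linarith) hab
  have hsum : α + β = 1 := by rw [hα, hβ]; field_simp; ring
  have hm : a * α + b * β = m := by rw [hα, hβ]; field_simp; ring
  have hl : mobius f a m = bernstein f.natDegree u (X + C α * 1) (C β * 1) := by
    apply mobius_eq_bernstein f hu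
    · intro x _; simpa using hβ0.ne'
    · intro x; simp; linear_combination hm
    · intro x; simp; linear_combination hsum
  have hr : mobius f m b = bernstein f.natDegree u (C α * X) (C β * X + 1) := by
    apply mobius_eq_bernstein f hu
    · intro x hx; simp; positivity
    · intro x; simp; linear_combination x * hm
    · intro x; simp; linear_combination x * hsum
  have hl' := bernstein_left α β f.natDegree u (X : ℚ[X]) 1
  have hr' := bernstein_right α β f.natDegree u (X : ℚ[X]) 1
  rw [var, var, var, hu, hl, hr]
  change bernstein f.natDegree u (X + C α * 1) (C β * 1) = _ at hl'
  change bernstein f.natDegree u (C α * X) (C β * X + 1) = _ at hr'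
  rw [hl', hr', signVariations_bernstein, signVariations_bernstein, signVariations_bernstein]
  simpa using signChanges_casteljau hα0 hβ0 f.natDegree u 0 []

theorem var_mono (f : ℤ[X]) {a b a' b' : ℚ} (ha : a ≤ a') (hab : a' < b') (hb : b' ≤ b) :
    var f a' b' ≤ var f a b := by
  have h1 : var f a' b ≤ var f a b := by
    rcases ha.eq_or_lt with rfl | ha
    · rfl
    · have := var_add_var_le f ha (hab.trans_le hb); omega
  have h2 : var f a' b' ≤ var f a' b := by
    rcases hb.eq_or_lt with rfl | hb
    · rfl
    · have := var_add_var_le f hab hb; omega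
  exact h2.trans h1

/-! ### Sign variations and roots in a sector. -/

/-- The polynomial with the coefficients `W i * p.coeff i`. -/
noncomputable def scaleCoeffs (W : ℕ → ℝ) (p : ℝ[X]) : ℝ[X] :=
  ∑ i ∈ Finset.range (p.natDegree + 1), monomial i (W i * p.coeff i)

theorem coeff_scaleCoeffs (W : ℕ → ℝ) (p : ℝ[X]) (i : ℕ) :
    (scaleCoeffs W p).coeff i = W i * p.coeff i := by
  simp only [scaleCoeffs, finsetSum_coeff, coeff_monomial, Finset.sum_ite_eq', Finset.mem_range]
  split_ifs with h
  · rfl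
  · rw [coeff_eq_zero_of_natDegree_lt (by omega), mul_zero]

theorem signVariations_of_coeff_eq_mul {p q : ℝ[X]} (W : ℕ → ℝ)
    (hW : ∀ i ≤ p.natDegree, 0 < W i) (h : ∀ i, q.coeff i = W i * p.coeff i) :
    q.signVariations = p.signVariations := by
  apply signVariations_congr
  intro i
  rcases le_or_gt i p.natDegree with hi | hi
  · rw [h, sign_mul, sign_pos (hW i hi), one_mul]
  · rw [h, coeff_eq_zero_of_natDegree_lt hi, mul_zero]

/-- The sequence σ i = sin((i + 1)φ) solves the recurrence of the quadratic factor, so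
multiplication by that factor decomposes into two multiplications by X - 1 with rescalings of the
coefficients in between. The rescalings use σ only up to index deg q + 2, where the angle hypothesis
makes it positive, so they keep all signs. Each factor X - 1 adds a variation, as in the proof of
Descartes' rule. -/
theorem signVariations_quadratic_mul {q : ℝ[X]} (hq : q ≠ 0) {r φ : ℝ} (hr : 0 < r) (hφ : 0 < φ)
    (hφ' : (q.natDegree + 3 : ℕ) * φ < Real.pi) :
    q.signVariations + 2 ≤
      ((X ^ 2 - C (2 * (r * Real.cos φ)) * X + C (r ^ 2)) * q).signVariations := by
  set m := q.natDegree with hm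
  let σ : ℕ → ℝ := fun i => Real.sin ((i + 1 : ℕ) * φ)
  have hσ : ∀ i ≤ m + 2, 0 < σ i := by
    intro i hi
    apply Real.sin_pos_of_pos_of_lt_pi
    · positivity
    · refine lt_of_le_of_lt ?_ hφ'
      exact mul_le_mul_of_nonneg_right (by exact_mod_cast (by omega : i + 1 ≤ m + 3)) hφ.le
  have hrec : ∀ i, σ i + σ (i + 2) = 2 * Real.cos φ * σ (i + 1) := by
    intro i
    simp only [σ]
    have e1 : ((i + 1 : ℕ) : ℝ) * φ = (i + 1 + 1 : ℕ) * φ - φ := by push_cast; ring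
    have e2 : ((i + 2 + 1 : ℕ) : ℝ) * φ = (i + 1 + 1 : ℕ) * φ + φ := by push_cast; ring
    rw [e1, e2, Real.sin_sub, Real.sin_add]; ring
  set t := scaleCoeffs (fun i => r ^ i / σ (i + 1)) q with ht
  set e := (X - C 1) * t with he
  set g := scaleCoeffs (fun i => σ i * σ (i + 1)) e with hg
  set h := (X - C 1) * g with hh
  have htc : ∀ i, σ (i + 1) * t.coeff i = r ^ i * q.coeff i := by
    intro i
    rw [ht, coeff_scaleCoeffs]
    rcases le_or_gt i m with hi | hi
    · have := (hσ (i + 1) (by omega)).ne'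
      field_simp
    · rw [coeff_eq_zero_of_natDegree_lt hi]; simp
  have htv : t.signVariations = q.signVariations :=
    signVariations_of_coeff_eq_mul _ (fun i hi => div_pos (pow_pos hr i) (hσ _ (by omega)))
      (coeff_scaleCoeffs _ q)
  have ht0 : t ≠ 0 := by
    intro h0
    have := htc m
    rw [h0, coeff_zero, mul_zero] at this
    have h1 : q.coeff m ≠ 0 := by simpa [hm] using hq
    have : r ^ m * q.coeff m ≠ 0 := mul_ne_zero (pow_pos hr m).ne' h1
    simp_all
  have htd : t.natDegree ≤ m := by
    rw [natDegree_le_iff_coeff_eq_zero]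
    intro i hi
    rw [ht, coeff_scaleCoeffs, coeff_eq_zero_of_natDegree_lt hi, mul_zero]
  have he0 : e ≠ 0 := mul_ne_zero (X_sub_C_ne_zero 1) ht0
  have hed : e.natDegree ≤ m + 1 := natDegree_mul_le.trans (by rw [natDegree_X_sub_C]; omega)
  have hgv : g.signVariations = e.signVariations :=
    signVariations_of_coeff_eq_mul _
      (fun i hi => mul_pos (hσ _ (by omega)) (hσ _ (by omega))) (coeff_scaleCoeffs _ e)
  have hg0 : g ≠ 0 := by
    intro h0
    have := coeff_scaleCoeffs (fun i => σ i * σ (i + 1)) e e.natDegree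
    rw [← hg, h0, coeff_zero] at this
    have h1 : e.leadingCoeff ≠ 0 := leadingCoeff_ne_zero.2 he0
    have h2 := (mul_pos (hσ e.natDegree (by omega)) (hσ (e.natDegree + 1) (by omega))).ne'
    exact mul_ne_zero h2 h1 this.symm
  have hgc : ∀ i, g.coeff i = σ i * σ (i + 1) * e.coeff i := coeff_scaleCoeffs _ e
  have hec : ∀ i, e.coeff (i + 1) = t.coeff i - t.coeff (i + 1) := by
    intro i; rw [he, sub_mul, coeff_sub, coeff_X_mul, coeff_C_mul, one_mul]
  have hec0 : e.coeff 0 = - t.coeff 0 := by simp [he, mul_coeff_zero]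
  have hhc : ∀ i, h.coeff (i + 1) = g.coeff i - g.coeff (i + 1) := by
    intro i; rw [hh, sub_mul, coeff_sub, coeff_X_mul, coeff_C_mul, one_mul]
  have hhc0 : h.coeff 0 = - g.coeff 0 := by simp [hh, mul_coeff_zero]
  set c := (X ^ 2 - C (2 * (r * Real.cos φ)) * X + C (r ^ 2)) * q with hc
  have hcexp : c = X * (X * q) - C (2 * (r * Real.cos φ)) * (X * q) + C (r ^ 2) * q := by
    rw [hc]; ring
  have key : ∀ i, r ^ 2 * h.coeff i = σ i * r ^ i * c.coeff i := by
    intro i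
    rcases i with _ | _ | i
    · have e0 := htc 0
      rw [hhc0, hgc, hec0, hcexp]
      simp only [coeff_add, coeff_sub, coeff_C_mul, coeff_X_mul_zero, zero_add, pow_zero]
      simp at e0
      linear_combination r ^ 2 * σ 0 * e0
    · have e0 := htc 0
      have e1 := htc 1
      have e2 := hrec 0
      rw [hhc, hgc, hgc, hec0, hec, hcexp]
      simp only [coeff_add, coeff_sub, coeff_C_mul, coeff_X_mul, coeff_X_mul_zero, zero_add,
        pow_one]
      simp at e0 e1 e2
      linear_combination r ^ 2 * σ 1 * (-t.coeff 0 * e2 - 2 * Real.cos φ * e0 + e1)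
    · have e0 := htc i
      have e1 := htc (i + 1)
      have e2 := htc (i + 2)
      have e3 := hrec (i + 1)
      rw [hhc, hgc, hgc, hec, hec, hcexp]
      simp only [coeff_add, coeff_sub, coeff_C_mul, coeff_X_mul]
      simp only [add_assoc, Nat.reduceAdd] at e0 e1 e2 e3 ⊢
      linear_combination r ^ 2 * σ (i + 2) * (-t.coeff (i + 1) * e3 - 2 * Real.cos φ * e1 + e2 + e0)
  have hcd : c.natDegree ≤ m + 2 := by
    refine natDegree_mul_le.trans ?_
    have : (X ^ 2 - C (2 * (r * Real.cos φ)) * X + C (r ^ 2)).natDegree ≤ 2 := by compute_degree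
    omega
  have hcv : h.signVariations = c.signVariations := by
    apply signVariations_of_coeff_eq_mul (fun i => σ i * r ^ i / r ^ 2)
    · intro i hi
      exact div_pos (mul_pos (hσ i (by omega)) (pow_pos hr i)) (pow_pos hr 2)
    · intro i
      have := key i
      field_simp
      linear_combination this
  have h1 := succ_signVariations_le_X_sub_C_mul (η := (1 : ℝ)) one_pos ht0
  have h2 := succ_signVariations_le_X_sub_C_mul (η := (1 : ℝ)) one_pos hg0
  rw [← he] at h1
  rw [← hh] at h2
  omega

/-- |arg z| ≤ tan |arg z| = |Im z| / Re z ≤ 1 / (n + 1). -/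
theorem abs_arg_mul_lt_pi {n : ℕ} {z : ℂ} (hre : 0 < z.re) (him : (n + 1) * |z.im| ≤ z.re) :
    (n + 1) * |z.arg| < Real.pi := by
  have h1 : |z.arg| < Real.pi / 2 := Complex.abs_arg_lt_pi_div_two_iff.2 (Or.inl hre)
  have h2 : |z.arg| ≤ |z.im| / z.re := by
    have h := Real.le_tan (abs_nonneg z.arg) h1
    have h3 : Real.tan |z.arg| = |z.im| / z.re := by
      rcases abs_cases z.arg with ⟨h4, h5⟩ | ⟨h4, h5⟩
      · rw [h4, Complex.tan_arg, abs_of_nonneg (Complex.arg_nonneg_iff.1 h5)]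
      · rw [h4, Real.tan_neg, Complex.tan_arg, abs_of_neg (Complex.arg_neg_iff.1 h5), neg_div]
    rwa [h3] at h
  have h4 : (n + 1) * (|z.im| / z.re) ≤ 1 := by
    rw [← mul_div_assoc, div_le_one hre]; exact him
  have h5 : (0 : ℝ) ≤ n + 1 := by positivity
  have := mul_le_mul_of_nonneg_left h2 h5
  linarith [Real.pi_gt_three]

/-- A real polynomial has at least as many sign variations as complex roots in a narrow sector
around the positive real axis. -/
theorem card_roots_sector_le_signVariations {n : ℕ} {p : ℝ[X]} (hp : p ≠ 0)
    (hn : p.natDegree ≤ n) (S : Finset ℂ)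
    (hS : ∀ z ∈ S, aeval z p = 0 ∧ 0 < z.re ∧ (n + 1) * |z.im| ≤ z.re) :
    S.card ≤ p.signVariations := by
  induction hd : p.natDegree using Nat.strong_induction_on generalizing p S with
  | _ d ih =>
  rcases S.eq_empty_or_nonempty with rfl | ⟨z, hz⟩
  · simp
  obtain ⟨hz0, hre, him⟩ := hS z hz
  by_cases him0 : z.im = 0
  · have hzr : z = (z.re : ℂ) := Complex.ext (by simp) (by simp [him0])
    have hroot : p.IsRoot z.re := by
      rw [hzr] at hz0
      have : aeval ((algebraMap ℝ ℂ) z.re) p = 0 := hz0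
      rw [aeval_algebraMap_apply] at this
      simpa using this
    obtain ⟨q, rfl⟩ := dvd_iff_isRoot.2 hroot
    have hq : q ≠ 0 := right_ne_zero_of_mul hp
    have hdq : ((X - C z.re) * q).natDegree = 1 + q.natDegree := by
      rw [natDegree_mul (X_sub_C_ne_zero _) hq, natDegree_X_sub_C]
    have h1 := succ_signVariations_le_X_sub_C_mul hre hq
    have h2 := ih q.natDegree (by omega) hq (by omega) (S.erase z) (fun y hy => by
      obtain ⟨hy1, hy2⟩ := Finset.mem_erase.1 hy
      obtain ⟨h1, h2⟩ := hS y hy2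
      refine ⟨?_, h2⟩
      rw [map_mul, mul_eq_zero] at h1
      refine h1.resolve_left ?_
      intro h
      apply hy1
      rw [hzr]
      simpa [sub_eq_zero] using h) rfl
    have h3 := Finset.card_erase_add_one hz
    omega
  · obtain ⟨q, rfl⟩ := p.quadratic_dvd_of_aeval_eq_zero_im_ne_zero hz0 him0
    have hq : q ≠ 0 := right_ne_zero_of_mul hp
    have hl : (X ^ 2 - C (2 * z.re) * X + C (‖z‖ ^ 2)) ≠ 0 := left_ne_zero_of_mul hp
    have hdl : (X ^ 2 - C (2 * z.re) * X + C (‖z‖ ^ 2)).natDegree = 2 := by compute_degree!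
    have hdq : ((X ^ 2 - C (2 * z.re) * X + C (‖z‖ ^ 2)) * q).natDegree = 2 + q.natDegree := by
      rw [natDegree_mul hl hq, hdl]
    have hz1 : 0 < ‖z‖ := by
      rw [norm_pos_iff]; rintro rfl; simp at hre
    have h1 := signVariations_quadratic_mul hq hz1 (φ := |z.arg|)
      (by rw [abs_pos]; intro h; exact him0 (Complex.arg_eq_zero_iff.1 h).2) (by
        refine lt_of_le_of_lt ?_ (abs_arg_mul_lt_pi hre him)
        gcongr
        -- The cofactor has degree at most n - 2, which is why n + 1 enters the sector condition.
        have : q.natDegree + 3 ≤ n + 1 := by omega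
        exact_mod_cast this)
    rw [Real.cos_abs, Complex.norm_mul_cos_arg] at h1
    have h2 := ih q.natDegree (by omega) hq (by omega) ((S.erase z).erase (star z))
      (fun y hy => by
      obtain ⟨hy1, hy2⟩ := Finset.mem_erase.1 hy
      obtain ⟨hy2, hy3⟩ := Finset.mem_erase.1 hy2
      obtain ⟨h1, h2⟩ := hS y hy3
      refine ⟨?_, h2⟩
      rw [map_mul, mul_eq_zero] at h1
      refine h1.resolve_left ?_
      intro h
      have : (y - z) * (y - star z) = 0 := by
        have e1 : z + star z = 2 * z.re := by
          simpa using Complex.add_conj z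
        have e2 : z * star z = (‖z‖ : ℂ) ^ 2 := Complex.mul_conj' z
        simp at h
        linear_combination h - y * e1 + e2
      rcases mul_eq_zero.1 this with h | h
      · exact hy2 (sub_eq_zero.1 h)
      · exact hy1 (sub_eq_zero.1 h)) rfl
    have h3 := Finset.card_erase_add_one hz
    -- The conjugate need not belong to `S`; at most two elements are lost for two variations.
    have h4 := Finset.pred_card_le_card_erase (s := S.erase z) (a := star z)
    omega

theorem coeff_comp_neg_X (p : ℝ[X]) (i : ℕ) : (p.comp (-X)).coeff i = (-1) ^ i * p.coeff i := by
  have : (-X : ℝ[X]) = C (-1) * X := by simp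
  rw [this, comp_C_mul_X_coeff, mul_comm]

/-- Induction by erasing the leading term. If the degree drops by at least 2, each summand may lose
one. If it drops by 1, the two leading signs are opposite in at most one of p(x) and p(-x), so only
one summand can lose. -/
theorem signVariations_add_comp_neg_le (p : ℝ[X]) :
    p.signVariations + (p.comp (-X)).signVariations ≤ p.natDegree := by
  induction hd : p.natDegree using Nat.strong_induction_on generalizing p with
  | _ d ih =>
  by_cases h0 : d = 0
  · obtain ⟨c, rfl⟩ := natDegree_eq_zero.1 (hd.trans h0)
    have := signVariations_monomial 0 c
    rw [← C_mul_X_pow_eq_monomial] at this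
    simp at this
    simp [this]
  have hp : p ≠ 0 := by rintro rfl; simp at hd; omega
  have hp' : p.comp (-X) ≠ 0 := by rwa [Ne, comp_neg_X_eq_zero_iff]
  have hd' : (p.comp (-X)).natDegree = d := by
    rw [natDegree_comp, natDegree_neg, natDegree_X, mul_one, hd]
  have he : (p.comp (-X)).eraseLead = p.eraseLead.comp (-X) := by
    ext i
    rw [coeff_comp_neg_X, eraseLead_coeff, eraseLead_coeff, coeff_comp_neg_X, hd', hd]
    split_ifs <;> simp
  have hed := eraseLead_natDegree_le p
  have h1 := ih p.eraseLead.natDegree (by omega) p.eraseLead rfl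
  rw [← he] at h1
  rcases (show p.eraseLead.natDegree + 2 ≤ d ∨ p.eraseLead.natDegree + 1 = d by omega) with h | h
  · have h2 := signVariations_le_eraseLead_succ p
    have h3 := signVariations_le_eraseLead_succ (p.comp (-X))
    omega
  · rw [signVariations_eq_eraseLead_add_ite hp, signVariations_eq_eraseLead_add_ite hp']
    have hl : (p.comp (-X)).leadingCoeff = (-1) ^ d * p.leadingCoeff := by
      rw [leadingCoeff, hd', coeff_comp_neg_X, leadingCoeff, hd]
    have hed' : (p.eraseLead.comp (-X)).natDegree = p.eraseLead.natDegree := by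
      rw [natDegree_comp, natDegree_neg, natDegree_X, mul_one]
    have hl' : (p.comp (-X)).eraseLead.leadingCoeff =
        (-1) ^ (p.eraseLead.natDegree) * p.eraseLead.leadingCoeff := by
      rw [he, leadingCoeff, hed', coeff_comp_neg_X, leadingCoeff]
    have hl0 : SignType.sign p.leadingCoeff ≠ 0 := by simpa using hp
    have hs : SignType.sign p.leadingCoeff = -SignType.sign p.eraseLead.leadingCoeff →
        SignType.sign ((-1) ^ d * p.leadingCoeff) ≠
          -SignType.sign ((-1) ^ p.eraseLead.natDegree * p.eraseLead.leadingCoeff) := by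
      intro hh
      rw [← h, pow_succ, sign_mul, sign_mul, sign_mul, hh]
      have hne : SignType.sign p.eraseLead.leadingCoeff ≠ 0 := by
        intro h; rw [h] at hh; exact hl0 (by rw [hh]; rfl)
      rcases neg_one_pow_eq_or ℝ p.eraseLead.natDegree with e | e <;> rw [e] <;>
      rcases hc : SignType.sign p.eraseLead.leadingCoeff with _ | _ | _ <;>
      simp_all
    rw [hl, hl']
    split_ifs with h2 h3
    · exact absurd h3 (hs h2)
    all_goals omega

/-! ### Complex roots near an interval and its variation count. -/

/-- The set of the complex roots of `f`. -/
noncomputable def complexRoots (f : ℤ[X]) : Finset ℂ :=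
  (f.map (Int.castRingHom ℂ)).roots.toFinset

theorem map_castRingHom_ne_zero {f : ℤ[X]} (hf : f ≠ 0) : f.map (Int.castRingHom ℂ) ≠ 0 :=
  (Polynomial.map_ne_zero_iff (RingHom.injective_int _)).2 hf

theorem mem_complexRoots {f : ℤ[X]} (hf : f ≠ 0) {z : ℂ} :
    z ∈ complexRoots f ↔ aeval z f = 0 := by
  rw [complexRoots, Multiset.mem_toFinset, mem_roots (map_castRingHom_ne_zero hf), IsRoot,
    eval_map, aeval_def]
  rfl

/-- Over the perfect field ℚ square-free means separable, and separability survives the extension to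
ℂ. -/
theorem separable_of_squarefree {f : ℤ[X]} (hf : Squarefree (f.map (Int.castRingHom ℚ))) :
    (f.map (Int.castRingHom ℂ)).Separable := by
  have h := (PerfectField.separable_iff_squarefree.2 hf).map (f := algebraMap ℚ ℂ)
  rwa [Polynomial.map_map, RingHom.ext_int ((algebraMap ℚ ℂ).comp (Int.castRingHom ℚ))
    (Int.castRingHom ℂ)] at h

theorem card_complexRoots {f : ℤ[X]} (hf : Squarefree (f.map (Int.castRingHom ℚ))) :
    (complexRoots f).card = f.natDegree := by
  rw [complexRoots, Multiset.toFinset_card_of_nodup (nodup_roots (separable_of_squarefree hf)),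
    ← (IsAlgClosed.splits (f.map (Int.castRingHom ℂ))).natDegree_eq_card_roots,
    natDegree_map_eq_of_injective (RingHom.injective_int _)]

theorem aeval_mobius (f : ℤ[X]) (a b : ℚ) (z : ℂ) : aeval z (mobius f a b) =
    ∑ i ∈ Finset.range (f.natDegree + 1),
      (f.coeff i : ℂ) * (a * z + b) ^ i * (z + 1) ^ (f.natDegree - i) := by
  simp [mobius]

/-- For a ≠ b, y ↦ (b - y)/(y - a) inverts x ↦ (ax + b)/(x + 1), so it carries the roots y ≠ a of f
to roots of f_I. -/
theorem aeval_mobius_div (f : ℤ[X]) (a b : ℚ) {y : ℂ} (hy : y ≠ a) :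
    aeval ((b - y) / (y - a)) (mobius f a b) =
      ((b - a) / (y - a)) ^ f.natDegree * aeval y f := by
  have hy' : y - a ≠ 0 := sub_ne_zero.2 hy
  rw [aeval_mobius, aeval_eq_sum_range, Finset.mul_sum]
  apply Finset.sum_congr rfl
  intro i hi
  have hi := Finset.mem_range.1 hi
  have e1 : (a : ℂ) * ((b - y) / (y - a)) + b = y * ((b - a) / (y - a)) := by field_simp; ring
  have e2 : (b - y) / (y - a) + 1 = ((b : ℂ) - a) / (y - a) := by field_simp; ring
  have e3 : ((b - a : ℂ) / (y - a)) ^ f.natDegree =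
      ((b - a) / (y - a)) ^ i * ((b - a) / (y - a)) ^ (f.natDegree - i) := by
    rw [← pow_add]; congr 1; omega
  rw [e1, e2, e3, mul_pow, zsmul_eq_mul]
  ring

theorem mobius_ne_zero {f : ℤ[X]} (hf : f ≠ 0) {a b : ℚ} (hab : a < b) : mobius f a b ≠ 0 := by
  intro h
  obtain ⟨y, hy⟩ := Infinite.exists_notMem_finset (insert (a : ℂ) (complexRoots f))
  rw [Finset.mem_insert, not_or, mem_complexRoots hf] at hy
  have h1 := aeval_mobius_div f a b hy.1
  rw [h, map_zero] at h1
  have h2 : (b : ℂ) - a ≠ 0 := sub_ne_zero.2 (by exact_mod_cast hab.ne')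
  exact mul_ne_zero (pow_ne_zero _ (div_ne_zero h2 (sub_ne_zero.2 hy.1))) hy.2 h1.symm

theorem mobius_quotient_injOn (a b : ℚ) (hab : a < b) :
    Set.InjOn (fun y : ℂ => (b - y) / (y - a)) {y | y ≠ a} := by
  intro y hy z hz h
  have hy' : y - a ≠ 0 := sub_ne_zero.2 hy
  have hz' : z - a ≠ 0 := sub_ne_zero.2 hz
  have h2 : (b : ℂ) - a ≠ 0 := sub_ne_zero.2 (by exact_mod_cast hab.ne')
  simp only at h
  rw [div_eq_div_iff hy' hz'] at h
  have : (b - a : ℂ) * (z - y) = 0 := by linear_combination h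
  exact (sub_eq_zero.1 ((mul_eq_zero.1 this).resolve_left h2)).symm

/-- The numerator is positive exactly on the open disk with diameter (a, b). Together with
`mobius_quotient_im` this turns the sector condition into the lens condition of `card_le_var`. -/
theorem mobius_quotient_re (a b : ℚ) (y : ℂ) : (((b : ℂ) - y) / (y - a)).re =
    ((b - y.re) * (y.re - a) - y.im ^ 2) / Complex.normSq (y - a) := by
  simp [Complex.div_re]; ring

theorem mobius_quotient_im (a b : ℚ) (y : ℂ) : (((b : ℂ) - y) / (y - a)).im =
    -(y.im * (b - a)) / Complex.normSq (y - a) := by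
  simp [Complex.div_im]; ring

theorem var_eq_signVariations_map (f : ℤ[X]) (a b : ℚ) :
    var f a b = ((mobius f a b).map (algebraMap ℚ ℝ)).signVariations := by
  apply signVariations_congr
  intro i
  rw [coeff_map, eq_ratCast (algebraMap ℚ ℝ)]
  rcases lt_trichotomy ((mobius f a b).coeff i) 0 with h | h | h
  · rw [sign_neg h, sign_neg (by exact_mod_cast h)]
  · simp [h]
  · rw [sign_pos h, sign_pos (by exact_mod_cast h)]

/-- The number of sign variations bounds the number of roots in a lens around the interval. -/
theorem card_le_var {f : ℤ[X]} (hf : f ≠ 0) {a b : ℚ} (hab : a < b) (S : Finset ℂ)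
    (hS : ∀ y ∈ S, aeval y f = 0 ∧ 0 < ((b : ℝ) - y.re) * (y.re - a) - y.im ^ 2 ∧
      (f.natDegree + 1) * (|y.im| * (b - a)) ≤ (b - y.re) * (y.re - a) - y.im ^ 2) :
    S.card ≤ var f a b := by
  have hab' : (0 : ℝ) < b - a := sub_pos.2 (by exact_mod_cast hab)
  have hne : ∀ y ∈ S, y ≠ a := by
    rintro y hy rfl
    simpa using (hS _ hy).2.1
  rw [var_eq_signVariations_map, ← Finset.card_image_of_injOn
    ((mobius_quotient_injOn a b hab).mono fun y hy => hne y hy)]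
  apply card_roots_sector_le_signVariations (n := f.natDegree)
  · exact (Polynomial.map_ne_zero_iff (algebraMap ℚ ℝ).injective).2 (mobius_ne_zero hf hab)
  · exact natDegree_map_le.trans (natDegree_mobius_le f a b)
  · intro z hz
    obtain ⟨y, hy, rfl⟩ := Finset.mem_image.1 hz
    obtain ⟨h1, h2, h3⟩ := hS y hy
    have hn : 0 < Complex.normSq (y - a) := Complex.normSq_pos.2 (sub_ne_zero.2 (hne y hy))
    refine ⟨?_, ?_, ?_⟩
    · rw [aeval_map_algebraMap, aeval_mobius_div f a b (hne y hy), h1, mul_zero]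
    · rw [mobius_quotient_re]; exact div_pos h2 hn
    · rw [mobius_quotient_re, mobius_quotient_im, abs_div, abs_neg, abs_mul, abs_of_pos hab',
        abs_of_pos hn, ← mul_div_assoc]
      gcongr

/-- The number of sign variations is at most the number of roots that are not far from the
interval. -/
theorem var_le_card {f : ℤ[X]} (hf : Squarefree (f.map (Int.castRingHom ℚ))) {a b : ℚ}
    (hab : a < b) :
    var f a b ≤
      ((complexRoots f).filter fun y : ℂ => ‖y - a‖ < (f.natDegree + 2) * (b - a)).card := by
  have hf0 : f ≠ 0 := by rintro rfl; simp at hf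
  have hab' : (0 : ℝ) < b - a := sub_pos.2 (by exact_mod_cast hab)
  set n := f.natDegree with hn
  set S := (complexRoots f).filter fun y : ℂ => ¬ ‖y - a‖ < (n + 2) * (b - a) with hS
  have hcard := Finset.card_filter_add_card_filter_not (s := complexRoots f)
    (fun y : ℂ => ‖y - a‖ < (n + 2) * (b - a))
  rw [card_complexRoots hf, ← hS] at hcard
  set p := (mobius f a b).map (algebraMap ℚ ℝ) with hp
  have hp0 : p ≠ 0 := 
    (Polynomial.map_ne_zero_iff (algebraMap ℚ ℝ).injective).2 (mobius_ne_zero hf0 hab)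
  have hpd : p.natDegree ≤ n := natDegree_map_le.trans (natDegree_mobius_le f a b)
  have hfar : ∀ y ∈ S, (n + 2) * (b - a) ≤ ‖y - a‖ := fun y hy =>
    not_lt.1 (Finset.mem_filter.1 hy).2
  have hne : ∀ y ∈ S, y ≠ a := by
    rintro y hy rfl
    have := hfar _ hy
    rw [sub_self, norm_zero] at this
    have : (0 : ℝ) < (n + 2) * (b - a) := by positivity
    linarith
  -- Far roots are mapped close to -1, into the sector about the negative axis, and are counted by
  -- f_I(-x). The variations of f_I(x) and f_I(-x) add up to at most n, the number of all roots, so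
  -- those of f_I(x) are at most the near roots.
  have h1 : S.card ≤ (p.comp (-X)).signVariations := by
    rw [← Finset.card_image_of_injOn (f := fun y : ℂ => -((b - y) / (y - a)))
      (neg_injective.comp_injOn ((mobius_quotient_injOn a b hab).mono fun y hy => hne y hy))]
    apply card_roots_sector_le_signVariations (n := n)
    · rwa [Ne, comp_neg_X_eq_zero_iff]
    · rw [natDegree_comp, natDegree_neg, natDegree_X, mul_one]; exact hpd
    · intro z hz
      obtain ⟨y, hy, rfl⟩ := Finset.mem_image.1 hz
      have hn : 0 < Complex.normSq (y - a) := Complex.normSq_pos.2 (sub_ne_zero.2 (hne y hy))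
      have hm := hfar y hy
      have him : |y.im| ≤ ‖y - a‖ := by simpa using Complex.abs_im_le_norm (y - a)
      have hre : |y.re - a| ≤ ‖y - a‖ := by simpa using Complex.abs_re_le_norm (y - a)
      have hsq : ‖y - a‖ ^ 2 = (y.re - a) ^ 2 + y.im ^ 2 := by
        rw [← Complex.normSq_eq_norm_sq, Complex.normSq_apply]; simp; ring
      -- With w = b - a and m = ‖y - a‖, the right side is m² - w Re(y - a) ≥ m(m - w), and m ≥ (n +
      -- 2)w.
      have hkey : (n + 1) * (‖y - a‖ * (b - a)) ≤
          -((b - y.re) * (y.re - a) - y.im ^ 2) := by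
        have h2 := le_abs_self (y.re - a)
        have h3 : (y.re - a) * (b - a) ≤ ‖y - a‖ * (b - a) := by gcongr; linarith
        have h4 : ‖y - a‖ * ((n + 2) * (b - a)) ≤ ‖y - a‖ * ‖y - a‖ := by gcongr
        nlinarith
      have hpos : 0 < ‖y - a‖ := norm_pos_iff.2 (sub_ne_zero.2 (hne y hy))
      refine ⟨?_, ?_, ?_⟩
      · rw [aeval_comp, map_neg, aeval_X, neg_neg, aeval_map_algebraMap,
          aeval_mobius_div f a b (hne y hy),
          (mem_complexRoots hf0).1 (Finset.mem_filter.1 hy).1, mul_zero]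
      · rw [Complex.neg_re, mobius_quotient_re, ← neg_div]
        apply div_pos (lt_of_lt_of_le (by positivity) hkey) hn
      · rw [Complex.neg_re, Complex.neg_im, mobius_quotient_re, mobius_quotient_im, abs_neg,
          abs_div, abs_neg, abs_mul, abs_of_pos hab', abs_of_pos hn, ← mul_div_assoc, ← neg_div]
        gcongr
        refine le_trans ?_ hkey
        gcongr
  have h2 := signVariations_add_comp_neg_le p
  rw [var_eq_signVariations_map, ← hp]
  omega

theorem var_le_natDegree {f : ℤ[X]} (a b : ℚ) : var f a b ≤ f.natDegree := by
  rw [var_eq_signVariations_map]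
  have h := signVariations_add_comp_neg_le ((mobius f a b).map (algebraMap ℚ ℝ))
  have : ((mobius f a b).map (algebraMap ℚ ℝ)).natDegree ≤ f.natDegree :=
    natDegree_map_le.trans (natDegree_mobius_le f a b)
  omega

/-- If the subinterval `[a', b']` of `(a, b)` is far from the endpoints `a` and `b`, then at most
`var(f, (a, b))` roots are close to `[a', b']`. -/
theorem card_near_le_var {f : ℤ[X]} (hf : f ≠ 0) {a b : ℚ} (hab : a < b) {ρ : ℝ} (hρ : 0 < ρ)
    (S : Finset ℂ) (hS : ∀ y ∈ S, aeval y f = 0 ∧ ∃ t : ℝ, a + ρ ≤ t ∧ t + ρ ≤ b ∧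
      2 * (f.natDegree + 2) * ‖y - t‖ ≤ ρ) :
    S.card ≤ var f a b := by
  apply card_le_var hf hab
  intro y hy
  obtain ⟨h1, t, h2, h3, h4⟩ := hS y hy
  have him : |y.im| ≤ ‖y - t‖ := by simpa using Complex.abs_im_le_norm (y - t)
  have hre : |y.re - t| ≤ ‖y - t‖ := by simpa using Complex.abs_re_le_norm (y - t)
  set ε := ‖y - t‖
  have hε : 0 ≤ ε := norm_nonneg _
  obtain ⟨hre1, hre2⟩ := abs_le.1 hre
  have hn : (0 : ℝ) ≤ f.natDegree := by positivity
  have hερ : 4 * ε ≤ ρ := by nlinarith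
  have him2 : y.im ^ 2 ≤ ε ^ 2 := by rw [← sq_abs]; gcongr
  have h5 : (b - t - ε) * (t - a - ε) ≤ (b - y.re) * (y.re - a) :=
    mul_le_mul (by linarith) (by linarith) (by linarith) (by linarith)
  -- One of the factors is at least (b - a)/2 and the other at least ρ.
  have h6 : ρ * (b - a) ≤ 2 * ((b - t) * (t - a)) := by nlinarith
  have hw : (0 : ℝ) < b - a := by linarith
  have h7 : (2 * (f.natDegree + 2) * ε) * (b - a) ≤ ρ * (b - a) := by gcongr
  have h8 : (f.natDegree + 2) * ε * (b - a) ≤ (b - t) * (t - a) := by linarith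
  have h9 : (f.natDegree + 1) * (|y.im| * (b - a)) ≤ (f.natDegree + 1) * (ε * (b - a)) := by gcongr
  have h10 : (f.natDegree + 1) * (ε * (b - a)) ≤ (b - y.re) * (y.re - a) - y.im ^ 2 := by
    nlinarith
  refine ⟨h1, ?_, h9.trans h10⟩
  have h11 : ε * (b - a) ≤ ρ / 4 * (b - a) := by gcongr; linarith
  have : 0 < ρ * (b - a) := by positivity
  nlinarith

/-! ### Root bound, resultant and root separation. -/

theorem map_eq_prod_complexRoots {f : ℤ[X]} (hf : Squarefree (f.map (Int.castRingHom ℚ))) :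
    f.map (Int.castRingHom ℂ) =
      C (f.leadingCoeff : ℂ) * ∏ z ∈ complexRoots f, (X - C z) := by
  have h := (IsAlgClosed.splits (f.map (Int.castRingHom ℂ))).eq_prod_roots
  rw [leadingCoeff_map_of_injective (RingHom.injective_int _)] at h
  rw [complexRoots, Finset.prod, Multiset.toFinset_val,
    Multiset.dedup_eq_self.2 (nodup_roots (separable_of_squarefree hf))]
  exact h

theorem eval_derivative_of_mem_complexRoots {f : ℤ[X]}
    (hf : Squarefree (f.map (Int.castRingHom ℚ))) {y : ℂ} (hy : y ∈ complexRoots f) :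
    (f.map (Int.castRingHom ℂ)).derivative.eval y =
      f.leadingCoeff * ∏ z ∈ (complexRoots f).erase y, (y - z) := by
  rw [map_eq_prod_complexRoots hf, ← Finset.mul_prod_erase _ _ hy]
  simp [derivative_mul, eval_prod]

theorem norm_le_of_mem_complexRoots {f : ℤ[X]} {τ : ℕ} (hf : f ≠ 0)
    (hτ : ∀ i, |f.coeff i| < 2 ^ τ) {y : ℂ} (hy : y ∈ complexRoots f) : ‖y‖ ≤ 2 ^ (τ + 1) := by
  have hf' := map_castRingHom_ne_zero hf
  have hroot : (f.map (Int.castRingHom ℂ)).IsRoot y :=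
    isRoot_of_mem_roots (Multiset.mem_toFinset.1 hy)
  have h : ‖y‖ ≤ cauchyBound (f.map (Int.castRingHom ℂ)) :=
    (hroot.norm_lt_cauchyBound hf').le
  refine h.trans ?_
  have hl : (1 : NNReal) ≤ ‖(f.map (Int.castRingHom ℂ)).leadingCoeff‖₊ := by
    rw [leadingCoeff_map_of_injective (RingHom.injective_int _)]
    have : (1 : ℤ) ≤ |f.leadingCoeff| := Int.one_le_abs (leadingCoeff_ne_zero.2 hf)
    rw [← NNReal.coe_le_coe]
    simpa [Int.norm_eq_abs] using (by exact_mod_cast this : (1 : ℝ) ≤ |(f.leadingCoeff : ℝ)|)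
  have hs : (Finset.range (f.map (Int.castRingHom ℂ)).natDegree).sup
      (‖(f.map (Int.castRingHom ℂ)).coeff ·‖₊) ≤ (2 : NNReal) ^ τ := by
    apply Finset.sup_le
    intro i _
    rw [← NNReal.coe_le_coe]
    simpa [Int.norm_eq_abs] using (by exact_mod_cast (hτ i).le : |(f.coeff i : ℝ)| ≤ 2 ^ τ)
  have hb : cauchyBound (f.map (Int.castRingHom ℂ)) ≤ 2 ^ τ + 1 := by
    rw [cauchyBound]
    gcongr
    exact (div_le_self zero_le hl).trans hs
  have hb' : (cauchyBound (f.map (Int.castRingHom ℂ)) : ℝ) ≤ 2 ^ τ + 1 := by exact_mod_cast hb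
  have : (1 : ℝ) ≤ 2 ^ τ := one_le_pow₀ one_le_two
  rw [pow_succ]; linarith

/-- The number inside the norm is the resultant of f and f', an integer that is nonzero by
separability. -/
theorem one_le_norm_resultant {f : ℤ[X]} (hf : Squarefree (f.map (Int.castRingHom ℚ)))
    (hn : 1 ≤ f.natDegree) :
    1 ≤ ‖(f.leadingCoeff : ℂ) ^ (f.natDegree - 1) *
      ∏ y ∈ complexRoots f, (f.map (Int.castRingHom ℂ)).derivative.eval y‖ := by
  set g := f.map (Int.castRingHom ℂ) with hg
  have hdeg : g.natDegree = f.natDegree := natDegree_map_eq_of_injective (RingHom.injective_int _) f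
  have hdd : g.derivative.natDegree = g.natDegree - 1 :=
    natDegree_eq_of_degree_eq_some (by
      rw [degree_derivative (by omega)])
  have h1 := resultant_eq_prod_eval g g.derivative (g.natDegree - 1) hdd.le (IsAlgClosed.splits g)
  have h2 : resultant g g.derivative ≠ 0 := resultant_ne_zero _ _ (separable_of_squarefree hf)
  rw [hdd, h1] at h2
  have h3 : (g.roots.map fun y => g.derivative.eval y).prod =
      ∏ y ∈ complexRoots f, g.derivative.eval y := by
    rw [complexRoots, Finset.prod, Multiset.toFinset_val,
      Multiset.dedup_eq_self.2 (nodup_roots (separable_of_squarefree hf))]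
  have h4 : g.leadingCoeff = f.leadingCoeff := by
    rw [hg, leadingCoeff_map_of_injective (RingHom.injective_int _)]; rfl
  have h5 := resultant_map_map f f.derivative f.natDegree (f.natDegree - 1) (Int.castRingHom ℂ)
  rw [← derivative_map, ← hg, ← hdeg, h1] at h5
  rw [h3, h4, hdeg] at h2 h5
  rw [h5] at h2 ⊢
  set r := resultant f f.derivative f.natDegree (f.natDegree - 1)
  have hr : r ≠ 0 := by rintro h; simp [h] at h2
  have : (1 : ℤ) ≤ |r| := Int.one_le_abs hr
  simpa using (by exact_mod_cast this : (1 : ℝ) ≤ |(r : ℝ)|)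

/-- A lower bound for the distance of two roots of a square-free integer polynomial. -/
theorem root_separation {f : ℤ[X]} {τ : ℕ} (hf : Squarefree (f.map (Int.castRingHom ℚ)))
    (hn : 1 ≤ f.natDegree) (hτ : ∀ i, |f.coeff i| < 2 ^ τ) (hτ1 : 1 ≤ τ) {y z : ℂ}
    (hy : y ∈ complexRoots f) (hz : z ∈ complexRoots f) (hyz : y ≠ z) :
    1 ≤ ‖y - z‖ * 2 ^ (5 * f.natDegree ^ 2 * τ) := by
  have hf0 : f ≠ 0 := by rintro rfl; simp at hn
  set n := f.natDegree
  set D : ℝ := 2 ^ (τ + 2) with hD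
  have hD1 : 1 ≤ D := one_le_pow₀ one_le_two
  have hdist : ∀ y ∈ complexRoots f, ∀ z ∈ complexRoots f, ‖y - z‖ ≤ D := by
    intro y hy z hz
    refine (norm_sub_le _ _).trans ?_
    have := norm_le_of_mem_complexRoots hf0 hτ hy
    have := norm_le_of_mem_complexRoots hf0 hτ hz
    rw [hD, pow_succ (n := τ + 1)]; linarith
  have hprod : ∀ x ∈ complexRoots f, ∀ s ⊆ complexRoots f, ∏ w ∈ s, ‖x - w‖ ≤ D ^ n := by
    intro x hx s hs
    calc ∏ w ∈ s, ‖x - w‖ ≤ ∏ _w ∈ s, D :=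
          Finset.prod_le_prod (fun _ _ => norm_nonneg _) fun w hw => hdist x hx w (hs hw)
      _ = D ^ s.card := by simp
      _ ≤ D ^ n := by
        gcongr
        exact (Finset.card_le_card hs).trans (card_complexRoots hf).le
  have hlead : ‖(f.leadingCoeff : ℂ)‖ ≤ 2 ^ τ := by
    simpa using (by exact_mod_cast (hτ f.natDegree).le : |(f.leadingCoeff : ℝ)| ≤ 2 ^ τ)
  have hder : ∀ x ∈ complexRoots f,
      ‖(f.map (Int.castRingHom ℂ)).derivative.eval x‖ ≤ 2 ^ τ * D ^ n := by
    intro x hx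
    rw [eval_derivative_of_mem_complexRoots hf hx, norm_mul, norm_prod]
    gcongr
    exact hprod x hx _ (Finset.erase_subset _ _)
  have hdery : ‖(f.map (Int.castRingHom ℂ)).derivative.eval y‖ ≤ ‖y - z‖ * (2 ^ τ * D ^ n) := by
    rw [eval_derivative_of_mem_complexRoots hf hy, norm_mul, norm_prod,
      ← Finset.mul_prod_erase _ _ (Finset.mem_erase.2 ⟨hyz.symm, hz⟩)]
    have := hprod y hy (((complexRoots f).erase y).erase z)
      ((Finset.erase_subset _ _).trans (Finset.erase_subset _ _))
    calc _ ≤ 2 ^ τ * (‖y - z‖ * D ^ n) := by gcongr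
      _ = _ := by ring
  -- Every factor of the resultant is bounded from above by powers of 2^τ and of D, which bounds the
  -- distances of roots. Only the factor ‖y - z‖ is kept.
  have h := one_le_norm_resultant hf hn
  rw [norm_mul, norm_pow, norm_prod, ← Finset.mul_prod_erase _ _ hy] at h
  have hrest : ∏ x ∈ (complexRoots f).erase y,
      ‖(f.map (Int.castRingHom ℂ)).derivative.eval x‖ ≤ (2 ^ τ * D ^ n) ^ (n - 1) := by
    calc _ ≤ ∏ _x ∈ (complexRoots f).erase y, (2 ^ τ * D ^ n) :=
          Finset.prod_le_prod (fun _ _ => norm_nonneg _) fun w hw =>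
            hder w (Finset.mem_of_mem_erase hw)
      _ = _ := by rw [Finset.prod_const, Finset.card_erase_of_mem hy, card_complexRoots hf]
  calc 1 ≤ _ := h
    _ ≤ (2 ^ τ) ^ (n - 1) * (‖y - z‖ * (2 ^ τ * D ^ n) * (2 ^ τ * D ^ n) ^ (n - 1)) := by
      gcongr
    _ = ‖y - z‖ * ((2 ^ τ) ^ (n - 1) * (2 ^ τ * D ^ n) ^ n) := by
      obtain ⟨k, hk⟩ : ∃ k, n = k + 1 := ⟨n - 1, by omega⟩
      rw [hk, Nat.add_sub_cancel, pow_succ (2 ^ τ * D ^ (k + 1)) k]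
      ring
    _ ≤ ‖y - z‖ * 2 ^ (5 * n ^ 2 * τ) := by
      gcongr
      -- The exponent is τ(n - 1) + n(τ + n(τ + 2)), at most 5n²τ since n, τ ≥ 1.
      rw [hD, ← pow_mul, ← pow_mul, ← pow_add, ← pow_mul, ← pow_add]
      apply pow_le_pow_right₀ one_le_two
      obtain ⟨k, hk⟩ : ∃ k, n = k + 1 := ⟨n - 1, by omega⟩
      rw [hk, Nat.add_sub_cancel]
      obtain ⟨t, rfl⟩ : ∃ t, τ = t + 1 := ⟨τ - 1, by omega⟩
      ring_nf
      nlinarith [Nat.zero_le (k * t), Nat.zero_le (k ^ 2 * t)]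

/-- An interval with at least two sign variations is not too short. -/
theorem width_lower_bound {f : ℤ[X]} {τ : ℕ} (hf : Squarefree (f.map (Int.castRingHom ℚ)))
    (hn : 1 ≤ f.natDegree) (hτ : ∀ i, |f.coeff i| < 2 ^ τ) (hτ1 : 1 ≤ τ) {a b : ℚ}
    (hab : a < b) (hv : 2 ≤ var f a b) :
    1 ≤ ((b : ℝ) - a) * 2 ^ (5 * f.natDegree ^ 2 * τ + f.natDegree + 3) := by
  have h := hv.trans (var_le_card hf hab)
  obtain ⟨y, hy, z, hz, hyz⟩ := Finset.one_lt_card.1 h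
  rw [Finset.mem_filter] at hy hz
  have h1 := root_separation hf hn hτ hτ1 hy.1 hz.1 hyz
  have hab' : (0 : ℝ) < b - a := sub_pos.2 (by exact_mod_cast hab)
  have h2 : ‖y - z‖ ≤ 2 ^ (f.natDegree + 3) * (b - a) := by
    have h3 : ‖y - z‖ ≤ ‖y - a‖ + ‖z - a‖ := by
      rw [show y - z = (y - a) - (z - a) by ring]; exact norm_sub_le _ _
    have h4 : (f.natDegree : ℝ) + 2 ≤ 2 ^ (f.natDegree + 2) := by
      exact_mod_cast (Nat.lt_two_pow_self (n := f.natDegree + 2)).le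
    have h5 : (f.natDegree + 2) * ((b : ℝ) - a) ≤ 2 ^ (f.natDegree + 2) * (b - a) := by gcongr
    rw [pow_succ (n := f.natDegree + 2)]
    linarith [hy.2, hz.2]
  calc 1 ≤ ‖y - z‖ * 2 ^ (5 * f.natDegree ^ 2 * τ) := h1
    _ ≤ (2 ^ (f.natDegree + 3) * (b - a)) * 2 ^ (5 * f.natDegree ^ 2 * τ) := by gcongr
    _ = _ := by rw [add_assoc, pow_add _ _ (f.natDegree + 3)]; ring

/-! ### The Newton step near a cluster of roots. -/

theorem ratCast_newton (f : ℤ[X]) (v : ℕ) (t : ℚ) : ((newton f v t : ℚ) : ℂ) =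
    t - v * (aeval (t : ℂ) f / aeval (t : ℂ) (derivative f)) := by
  have h : ∀ g : ℤ[X], ((aeval t g : ℚ) : ℂ) = aeval (t : ℂ) g := fun g => by
    have := aeval_algebraMap_apply ℂ t g
    simpa using this.symm
  simp [newton, h]

theorem aeval_derivative_div_aeval {f : ℤ[X]} (hf : Squarefree (f.map (Int.castRingHom ℚ)))
    {t : ℂ} (ht : aeval t f ≠ 0) :
    aeval t (derivative f) / aeval t f = ∑ y ∈ complexRoots f, 1 / (t - y) := by
  have e : ∀ g : ℤ[X], aeval t g = (g.map (Int.castRingHom ℂ)).eval t := fun g => by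
    rw [eval_map, aeval_def]; rfl
  rw [e, e, ← derivative_map]
  rw [e] at ht
  rw [(IsAlgClosed.splits (f.map (Int.castRingHom ℂ))).eval_derivative_div_eval_of_ne_zero ht,
    complexRoots, Finset.sum, Multiset.toFinset_val,
    Multiset.dedup_eq_self.2 (nodup_roots (separable_of_squarefree hf))]

/-- If `v` roots of `f` are close to `c` and the others are far from `t`, then the Newton step for
a `v`-fold root leads from `t` to a point close to `c`. -/
theorem abs_newton_sub_le {f : ℤ[X]} (hf : Squarefree (f.map (Int.castRingHom ℚ))) {v : ℕ}
    (hv : 1 ≤ v) {t c : ℚ} {δ R D : ℝ} (hD : |(t : ℝ) - c| = D)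
    (hδ : 0 < δ) (hδD : 8 * δ ≤ D) (hR : 4 * D * f.natDegree ≤ R) (hR0 : 0 < R)
    (hcard : ((complexRoots f).filter fun y : ℂ => ‖y - c‖ < δ).card = v)
    (hfar : ∀ y ∈ complexRoots f, ¬ ‖y - c‖ < δ → R ≤ ‖y - t‖) :
    |(newton f v t : ℝ) - c| ≤ 4 * δ + 2 * D ^ 2 * f.natDegree / R := by
  have hf0 : f ≠ 0 := by rintro rfl; simp at hf
  have hv' : (1 : ℝ) ≤ v := by exact_mod_cast hv
  have hD0 : 0 < D := by linarith
  have hDn : ‖(t : ℂ) - c‖ = D := by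
    rw [← hD]
    have : (t : ℂ) - c = (((t : ℝ) - c : ℝ) : ℂ) := by push_cast; rfl
    rw [this, Complex.norm_real, Real.norm_eq_abs]
  have hnear : ∀ y : ℂ, ‖y - c‖ < δ → 7 / 8 * D ≤ ‖(t : ℂ) - y‖ := by
    intro y hy
    have : ‖(t : ℂ) - c‖ ≤ ‖(t : ℂ) - y‖ + ‖y - c‖ := norm_sub_le_norm_sub_add_norm_sub _ _ _
    linarith
  have ht : aeval (t : ℂ) f ≠ 0 := by
    intro h
    have hm := (mem_complexRoots hf0).2 h
    by_cases h1 : ‖(t : ℂ) - c‖ < δ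
    · linarith
    · have := hfar _ hm h1
      rw [sub_self, norm_zero] at this
      linarith
  set s := complexRoots f with hs
  set q := aeval (t : ℂ) (derivative f) / aeval (t : ℂ) f with hq
  have hq' := aeval_derivative_div_aeval hf ht
  -- (t - c)f'(t)/f(t) is the sum of (t - c)/(t - y) over the roots y. Each of the v near roots
  -- contributes 1 + (y - c)/(t - y), each far root at most D/R in norm. So E is small, and the
  -- error of the Newton step is exactly (t - c)E/(v + E).
  set E := (t - c : ℂ) * q - v with hE
  have hEeq : E = (∑ y ∈ s.filter (fun y : ℂ => ‖y - c‖ < δ), ((y - c) / (t - y) : ℂ)) +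
      ∑ y ∈ s.filter (fun y : ℂ => ¬ ‖y - c‖ < δ), ((t - c) / (t - y) : ℂ) := by
    rw [hE, hq, hq', ← Finset.sum_filter_add_sum_filter_not s (fun y : ℂ => ‖y - c‖ < δ), mul_add,
      Finset.mul_sum, Finset.mul_sum, ← hcard, Finset.card_eq_sum_ones, Nat.cast_sum,
      add_sub_right_comm, ← Finset.sum_sub_distrib]
    congr 1
    · apply Finset.sum_congr rfl
      intro y hy
      have h1 := hnear y (Finset.mem_filter.1 hy).2
      have h2 : (t : ℂ) - y ≠ 0 := by
        rw [← norm_pos_iff]; linarith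
      field_simp
      push_cast
      ring
    · apply Finset.sum_congr rfl
      intro y _
      ring
  have hE1 : ‖∑ y ∈ s.filter (fun y : ℂ => ‖y - c‖ < δ), ((y - c) / (t - y) : ℂ)‖ ≤
      v * (2 * δ / D) := by
    refine (norm_sum_le_of_le _ (f := fun y : ℂ => ((y - c) / (t - y) : ℂ))
      (n := fun _ => 2 * δ / D) ?_).trans ?_
    · intro y hy
      have h0 := (Finset.mem_filter.1 hy).2
      have h1 := hnear y h0
      rw [norm_div, div_le_div_iff₀ (by linarith) hD0]
      nlinarith
    · rw [Finset.sum_const, hcard, nsmul_eq_mul]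
  have hE2 : ‖∑ y ∈ s.filter (fun y : ℂ => ¬ ‖y - c‖ < δ), ((t - c) / (t - y) : ℂ)‖ ≤
      f.natDegree * (D / R) := by
    refine (norm_sum_le_of_le _ (f := fun y : ℂ => ((t - c) / (t - y) : ℂ))
      (n := fun _ => D / R) ?_).trans ?_
    · intro y hy
      have h1 := hfar y (Finset.mem_filter.1 hy).1 (Finset.mem_filter.1 hy).2
      rw [norm_sub_rev] at h1
      rw [norm_div, hDn]
      gcongr
    · rw [Finset.sum_const, nsmul_eq_mul]
      gcongr
      exact (Finset.card_filter_le _ _).trans (card_complexRoots hf).le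
  have hEn : ‖E‖ ≤ v * (2 * δ / D) + f.natDegree * (D / R) := by
    rw [hEeq]; exact (norm_add_le _ _).trans (add_le_add hE1 hE2)
  have h3 : 2 * δ / D ≤ 1 / 4 := by rw [div_le_div_iff₀ hD0 (by norm_num)]; linarith
  have h4 : f.natDegree * (D / R) ≤ 1 / 4 := by
    rw [← mul_div_assoc, div_le_div_iff₀ hR0 (by norm_num)]; linarith
  have h5 : v * (2 * δ / D) ≤ v * (1 / 4) := by gcongr
  have hEv : ‖E‖ ≤ v / 2 := by linarith
  have hvE : (v : ℝ) / 2 ≤ ‖(v + E : ℂ)‖ := by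
    have : ‖(v : ℂ)‖ ≤ ‖(v + E : ℂ)‖ + ‖E‖ := by
      have := norm_sub_le (v + E : ℂ) E
      rwa [add_sub_cancel_right] at this
    rw [Complex.norm_natCast] at this
    linarith
  have hvE0 : (v + E : ℂ) ≠ 0 := by rw [← norm_pos_iff]; linarith
  have htc : (t - c : ℂ) ≠ 0 := by rw [← norm_pos_iff, hDn]; exact hD0
  have hprod : (t - c : ℂ) * q = v + E := by rw [hE]; ring
  have hq0 : q ≠ 0 := by intro h; rw [h, mul_zero] at hprod; exact hvE0 hprod.symm
  have hlam : (newton f v t : ℂ) - c = (t - c) * E / (v + E) := by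
    rw [ratCast_newton, ← inv_div, ← hq, eq_div_iff hvE0, ← hprod, hE]
    field_simp
    ring
  have hnorm : |(newton f v t : ℝ) - c| = ‖((newton f v t : ℚ) : ℂ) - c‖ := by
    have : ((newton f v t : ℚ) : ℂ) - c = (((newton f v t : ℝ) - c : ℝ) : ℂ) := by
      push_cast; rfl
    rw [this, Complex.norm_real, Real.norm_eq_abs]
  rw [hnorm, hlam, norm_div, norm_mul, hDn]
  calc D * ‖E‖ / ‖(v + E : ℂ)‖
      ≤ D * (v * (2 * δ / D) + f.natDegree * (D / R)) / (v / 2) := by gcongr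
    _ = 4 * δ + (2 * D ^ 2 * f.natDegree / R) / v := by
      field_simp
      ring
    _ ≤ 4 * δ + 2 * D ^ 2 * f.natDegree / R := by
      exact add_le_add le_rfl (div_le_self (by positivity) hv')

theorem gridIndex_bounds (p : Active) (hN : 4 ≤ p.N) (l : ℚ) :
    2 ≤ p.gridIndex l ∧ p.gridIndex l ≤ 4 * p.N - 2 := by
  have : (4 : ℤ) ≤ p.N := by exact_mod_cast hN
  constructor
  · exact le_min (le_max_right _ _) (by omega)
  · exact min_le_right _ _

/-- In units of the mesh w/(4N), l and x have coordinates r and y with |r - y| ≤ 1, so y lies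
between ⌊r⌋ - 1 and ⌊r⌋ + 2. Clamping the index does no harm because 0 ≤ y ≤ 4N. -/
theorem mem_newtonInterval (p : Active) (hN : 4 ≤ p.N) (hw : 0 < p.width) {l x : ℚ}
    (hx1 : p.a ≤ x) (hx2 : x ≤ p.b) (hxl : |l - x| ≤ p.width / (4 * p.N)) :
    (p.newtonInterval l).a ≤ x ∧ x ≤ (p.newtonInterval l).b := by
  have hN0 : (0 : ℚ) < p.N := by exact_mod_cast (by omega : 0 < p.N)
  set h := p.width / (4 * p.N) with hh
  have hh0 : 0 < h := by positivity
  have hwh : p.b - p.a = 4 * p.N * h := by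
    rw [hh, Active.width]; field_simp
  set r := 4 * (p.N : ℚ) * ((l - p.a) / (p.b - p.a)) with hr
  have hrl : l - p.a = r * h := by
    rw [hr, hwh]; field_simp
  obtain ⟨h1, h2⟩ := abs_le.1 hxl
  have hfl := Int.floor_le r
  have hlt := Int.lt_floor_add_one r
  have hdef : p.gridIndex l = min (max ⌊r⌋ 2) (4 * (p.N : ℤ) - 2) := rfl
  have hN4 : (4 : ℤ) ≤ p.N := by exact_mod_cast hN
  simp only [Active.newtonInterval, ← hh]
  obtain ⟨y, hy⟩ : ∃ y, x = p.a + y * h := ⟨(x - p.a) / h, by field_simp; ring⟩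
  have hy0 : 0 ≤ y := by
    by_contra hc
    push Not at hc
    nlinarith
  have hy1 : y ≤ 4 * p.N := by
    by_contra hc
    push Not at hc
    nlinarith
  have hyr1 : y ≤ r + 1 := by
    have : y * h ≤ (r + 1) * h := by linarith
    exact le_of_mul_le_mul_right this hh0
  have hyr2 : r - 1 ≤ y := by
    have : (r - 1) * h ≤ y * h := by linarith
    exact le_of_mul_le_mul_right this hh0
  have key : (p.gridIndex l : ℚ) - 2 ≤ y ∧ y ≤ (p.gridIndex l : ℚ) + 2 := by
    rcases le_or_gt (max ⌊r⌋ 2) (4 * (p.N : ℤ) - 2) with hc | hc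
    · rw [hdef, min_eq_left hc]
      rcases le_or_gt ⌊r⌋ 2 with h3 | h3
      · rw [max_eq_right h3]
        have : (⌊r⌋ : ℚ) ≤ 2 := by exact_mod_cast h3
        push_cast
        constructor <;> linarith
      · rw [max_eq_left h3.le]
        constructor <;> linarith
    · rw [hdef, min_eq_right hc.le]
      have h3 : 4 * (p.N : ℤ) - 2 < ⌊r⌋ := by
        rcases lt_max_iff.1 hc with h | h <;> omega
      have : 4 * (p.N : ℚ) - 2 + 1 ≤ ⌊r⌋ := by exact_mod_cast h3
      push_cast
      constructor <;> linarith
  constructor <;> nlinarith [key.1, key.2]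

/-- If the roots close to the subinterval `(c, d)` form a cluster that is well separated from the
other roots, then one of the two Newton intervals contains `(c, d)`. -/
theorem exists_newtonInterval_contains {f : ℤ[X]} (hf : Squarefree (f.map (Int.castRingHom ℚ)))
    (hn : 1 ≤ f.natDegree) {v : ℕ} (hv : 1 ≤ v) {p : Active} (hN : 4 ≤ p.N) {c d : ℚ}
    (hpc : p.a ≤ c) (hcd : c < d) (hdp : d ≤ p.b) {R : ℝ}
    (hR : 16 * f.natDegree * (p.N * (p.width : ℝ)) ≤ R)
    (hw : p.N * (64 * (f.natDegree + 2) * ((d : ℝ) - c)) ≤ p.width)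
    (hcard : ((complexRoots f).filter fun y : ℂ =>
      ‖y - c‖ < (f.natDegree + 2) * ((d : ℝ) - c)).card = v)
    (hfar : ∀ y ∈ complexRoots f, ¬ ‖y - c‖ < (f.natDegree + 2) * ((d : ℝ) - c) →
      ∀ t : ℚ, p.a ≤ t → t ≤ p.b → R ≤ ‖y - t‖) :
    ∃ t, (t = p.a ∨ t = p.b) ∧ (p.newtonInterval (newton f v t)).a ≤ c ∧
      d ≤ (p.newtonInterval (newton f v t)).b := by
  have hcd' : (0 : ℝ) < d - c := sub_pos.2 (by exact_mod_cast hcd)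
  have hn' : (1 : ℝ) ≤ f.natDegree := by exact_mod_cast hn
  have hN' : (4 : ℝ) ≤ p.N := by exact_mod_cast hN
  set w := (p.width : ℝ) with hwdef
  set δ := (f.natDegree + 2) * ((d : ℝ) - c) with hδ
  have hδ0 : 0 < δ := by positivity
  have hδw : 64 * (p.N * δ) ≤ w := by rw [hδ]; linarith
  have hw0 : 0 < w := lt_of_lt_of_le (by positivity) hδw
  have hR0 : 0 < R := lt_of_lt_of_le (by positivity) hR
  have hab : w = (p.b : ℝ) - p.a := by rw [hwdef, Active.width]; push_cast; rfl
  have h1 : (p.a : ℝ) ≤ c := by exact_mod_cast hpc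
  have h2 : (d : ℝ) ≤ p.b := by exact_mod_cast hdp
  have hδcd : 3 * ((d : ℝ) - c) ≤ δ := by rw [hδ]; gcongr; linarith
  -- The endpoint farther from c is at distance at least w/2, hence far from the cluster compared to
  -- its radius δ.
  obtain ⟨t, ht, hD1, hD2⟩ : ∃ t, (t = p.a ∨ t = p.b) ∧ w / 2 ≤ |(t : ℝ) - c| ∧
      |(t : ℝ) - c| ≤ w := by
    rcases le_total ((c : ℝ) - p.a) (w / 2) with h | h
    · refine ⟨p.b, Or.inr rfl, ?_⟩
      rw [abs_of_nonneg (by linarith)]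
      constructor <;> linarith
    · refine ⟨p.a, Or.inl rfl, ?_⟩
      rw [abs_of_nonpos (by linarith)]
      constructor <;> linarith
  have htab : p.a ≤ t ∧ t ≤ p.b := by
    have : p.a ≤ p.b := by linarith
    rcases ht with rfl | rfl <;> constructor <;> first | exact le_rfl | exact this
  have hNw : w ≤ p.N * w := by nlinarith
  have hNδ : 4 * δ ≤ p.N * δ := by gcongr
  have hclose := abs_newton_sub_le hf hv (t := t) (c := c) (δ := δ) (R := R) rfl hδ0
    (by linarith) (by
      calc 4 * |(t : ℝ) - c| * f.natDegree ≤ 4 * w * f.natDegree := by gcongr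
        _ ≤ 16 * f.natDegree * (p.N * w) := by
          have : f.natDegree * w ≤ f.natDegree * (p.N * w) := by gcongr
          nlinarith
        _ ≤ R := hR) hR0 hcard (fun y hy h => hfar y hy h t htab.1 htab.2)
  -- 3/16 = 1/16 + 1/8, from the cluster radius and from the far roots. Adding d - c ≤ w/(192N)
  -- still stays below one mesh w/(4N), so both c and d are captured.
  have hsmall : |(newton f v t : ℝ) - c| ≤ 3 / 16 * (w / p.N) := by
    have e1 : 4 * δ ≤ 1 / 16 * (w / p.N) := by
      rw [← mul_div_assoc, le_div_iff₀ (by linarith)]; linarith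
    have e2 : 2 * |(t : ℝ) - c| ^ 2 * f.natDegree / R ≤ 1 / 8 * (w / p.N) := by
      rw [← mul_div_assoc, div_le_div_iff₀ hR0 (by linarith)]
      calc 2 * |(t : ℝ) - c| ^ 2 * f.natDegree * p.N ≤ 2 * w ^ 2 * f.natDegree * p.N := by gcongr
        _ = 1 / 8 * w * (16 * f.natDegree * (p.N * w)) := by ring
        _ ≤ 1 / 8 * w * R := by gcongr
    linarith
  have hcdw : (d : ℝ) - c ≤ 1 / 192 * (w / p.N) := by
    rw [← mul_div_assoc, le_div_iff₀ (by linarith)]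
    nlinarith
  have hwN : 0 < w / p.N := by positivity
  obtain ⟨h3, h4⟩ := abs_le.1 hsmall
  have hwq : 0 < p.width := by rw [hwdef] at hw0; exact_mod_cast hw0
  refine ⟨t, ht, (mem_newtonInterval p hN hwq hpc (hcd.le.trans hdp) ?_).1,
    (mem_newtonInterval p hN hwq (hpc.trans hcd.le) hdp ?_).2⟩
  · have : |(newton f v t : ℝ) - c| ≤ w / (4 * p.N) := by
      rw [mul_comm, ← div_div]; linarith
    rw [hwdef] at this
    exact_mod_cast this
  · have : |(newton f v t : ℝ) - d| ≤ w / (4 * p.N) := by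
      rw [mul_comm (4 : ℝ), ← div_div]
      apply abs_le.2
      constructor <;> linarith
    rw [hwdef] at this
    exact_mod_cast this

/-! ### Levels, widths and amortized counting of bisections. -/

/-- The binary logarithm of `N_I`. -/
noncomputable def Active.level (p : Active) : ℝ := Real.logb 2 p.N

/-- The binary logarithm of `w(I)`. -/
noncomputable def Active.logWidth (p : Active) : ℝ := Real.logb 2 p.width

/-- The form and the size of the active pairs that occur if all widths lie between `2 ^ (-B)` and
`2 ^ A`. -/
structure Valid (A B : ℕ) (p : Active) : Prop where
  form : ∃ m, p.N = 2 ^ 2 ^ (m + 1)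
  pos : 0 < p.width
  lower : -(B : ℝ) ≤ p.logWidth
  upper : p.logWidth ≤ A
  level_le : p.level ≤ 2 * (A + B)

/-- The position of a child in its parent. -/
structure Inside (p' p : Active) : Prop where
  pos : 0 < p'.width
  left_le : p.a ≤ p'.a
  le_right : p'.b ≤ p.b
  half : 2 * p'.width ≤ p.width
  left : p'.a = p.a ∨ p.a + p'.width / 4 ≤ p'.a
  right : p'.b = p.b ∨ p'.b + p'.width / 4 ≤ p.b

/-- `p'` arises from `p` by a quadratic step. -/
structure Shrinks (p p' : Active) : Prop extends Inside p' p where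
  N_eq : p'.N = p.N ^ 2
  width_eq : p'.width = p.width / p.N

/-- `p'` arises from `p` by a bisection. -/
structure Halves (p p' : Active) : Prop extends Inside p' p where
  N_eq : p'.N = max 4 p.N.sqrt
  width_eq : p'.width = p.width / 2

section Levels

variable {A B : ℕ} {p p' : Active}

theorem level_of_form {m : ℕ} (h : p.N = 2 ^ 2 ^ (m + 1)) : p.level = 2 ^ (m + 1) := by
  rw [Active.level, h]
  push_cast
  rw [Real.logb_pow, Real.logb_self_eq_one (by norm_num)]
  simp

theorem Valid.four_le (h : Valid A B p) : 4 ≤ p.N := by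
  obtain ⟨m, hm⟩ := h.form
  rw [hm]
  calc 4 = 2 ^ 2 ^ 1 := by norm_num
    _ ≤ 2 ^ 2 ^ (m + 1) := by
      apply Nat.pow_le_pow_right (by norm_num)
      apply Nat.pow_le_pow_right (by norm_num)
      omega

theorem Valid.level_cases (h : Valid A B p) : p.level = 2 ∨ 4 ≤ p.level := by
  obtain ⟨m, hm⟩ := h.form
  rw [level_of_form hm]
  rcases m with _ | m
  · left; norm_num
  · right
    rw [pow_succ, pow_succ]
    have : (1 : ℝ) ≤ 2 ^ m := one_le_pow₀ one_le_two
    linarith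

theorem Valid.two_le_level (h : Valid A B p) : 2 ≤ p.level := by
  rcases h.level_cases with h | h <;> linarith

theorem Valid.width_pos (h : Valid A B p) : (0 : ℝ) < p.width := by exact_mod_cast h.pos

theorem Valid.N_pos (h : Valid A B p) : (0 : ℝ) < p.N := by
  exact_mod_cast (by have := h.four_le; omega : 0 < p.N)

theorem Shrinks.level_eq (h : Shrinks p p') : p'.level = 2 * p.level := by
  rw [Active.level, h.N_eq]
  push_cast
  rw [Real.logb_pow, Active.level]
  norm_num

theorem Shrinks.logWidth_eq (h : Shrinks p p') (hp : Valid A B p) :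
    p'.logWidth = p.logWidth - p.level := by
  rw [Active.logWidth, h.width_eq]
  push_cast
  rw [Real.logb_div hp.width_pos.ne' hp.N_pos.ne']
  rfl

theorem Halves.logWidth_eq (h : Halves p p') (hp : Valid A B p) :
    p'.logWidth = p.logWidth - 1 := by
  rw [Active.logWidth, h.width_eq]
  push_cast
  rw [Real.logb_div hp.width_pos.ne' (by norm_num), Real.logb_self_eq_one (by norm_num)]
  rfl

theorem Halves.N_eq_of_form (h : Halves p p') {m : ℕ} (hm : p.N = 2 ^ 2 ^ (m + 1)) :
    p'.N = 2 ^ 2 ^ ((m - 1) + 1) := by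
  have hs : p.N.sqrt = 2 ^ 2 ^ m := by
    rw [hm, pow_succ 2 m, pow_mul, Nat.sqrt_eq']
  rw [h.N_eq, hs]
  rcases m with _ | m
  · norm_num
  · rw [max_eq_right]
    · simp
    · calc 4 = 2 ^ 2 ^ 1 := by norm_num
        _ ≤ 2 ^ 2 ^ (m + 1) := by
          apply Nat.pow_le_pow_right (by norm_num)
          apply Nat.pow_le_pow_right (by norm_num)
          omega

theorem Halves.level_eq (h : Halves p p') (hp : Valid A B p) (h4 : 4 ≤ p.level) :
    p'.level = p.level / 2 := by
  obtain ⟨m, hm⟩ := hp.form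
  rw [level_of_form (h.N_eq_of_form hm), level_of_form hm]
  rw [level_of_form hm] at h4
  rcases m with _ | m
  · norm_num at h4
  · rw [Nat.add_sub_cancel, pow_succ (2 : ℝ) (m + 1)]; ring

theorem Halves.level_eq_two (h : Halves p p') (hp : Valid A B p) (h2 : p.level = 2) :
    p'.level = 2 := by
  obtain ⟨m, hm⟩ := hp.form
  rw [level_of_form (h.N_eq_of_form hm)]
  rw [level_of_form hm] at h2
  rcases m with _ | m
  · norm_num
  · rw [pow_succ, pow_succ] at h2
    have : (1 : ℝ) ≤ 2 ^ m := one_le_pow₀ one_le_two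
    linarith

theorem Halves.half_level_le (h : Halves p p') (hp : Valid A B p) : p.level ≤ 2 * p'.level := by
  rcases hp.level_cases with h2 | h4
  · rw [h.level_eq_two hp h2]; linarith
  · rw [h.level_eq hp h4]; linarith

end Levels

/-- `Path A B F q k s p`: there is a sequence of `s` steps from `p` to `q`, of which `k` are
bisections; these take place only at active pairs with the property `F`. -/
inductive Path (A B : ℕ) (F : Active → Prop) (q : Active) : ℕ → ℕ → Active → Prop
  | refl (hq : Valid A B q) : Path A B F q 0 0 q
  | shrink {k s : ℕ} {p p' : Active} (hp : Valid A B p) (hs : Shrinks p p')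
      (h : Path A B F q k s p') : Path A B F q k (s + 1) p
  | halve {k s : ℕ} {p p' : Active} (hp : Valid A B p) (hs : Halves p p') (hF : F p)
      (h : Path A B F q k s p') : Path A B F q (k + 1) (s + 1) p

section Paths

variable {A B : ℕ} {F : Active → Prop} {p p' q q' : Active} {k s : ℕ}

theorem Path.valid (h : Path A B F q k s p) : Valid A B p := by
  cases h <;> assumption

theorem Path.valid_end (h : Path A B F q k s p) : Valid A B q := by
  induction h <;> assumption

theorem Path.contains (h : Path A B F q k s p) : p.a ≤ q.a ∧ q.b ≤ p.b := by
  induction h with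
  | refl => exact ⟨le_rfl, le_rfl⟩
  | shrink _ hs _ ih => exact ⟨hs.left_le.trans ih.1, ih.2.trans hs.le_right⟩
  | halve _ hs _ _ ih => exact ⟨hs.left_le.trans ih.1, ih.2.trans hs.le_right⟩

theorem Path.snoc_shrink (h : Path A B F q k s p) (hs : Shrinks q q') (hq' : Valid A B q') :
    Path A B F q' k (s + 1) p := by
  induction h with
  | refl hq => exact .shrink hq hs (.refl hq')
  | shrink hp hs' _ ih => exact .shrink hp hs' ih
  | halve hp hs' hF _ ih => exact .halve hp hs' hF ih

theorem Path.snoc_halve (h : Path A B F q k s p) (hs : Halves q q') (hF : F q)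
    (hq' : Valid A B q') : Path A B F q' (k + 1) (s + 1) p := by
  induction h with
  | refl hq => exact .halve hq hs hF (.refl hq')
  | shrink hp hs' _ ih => exact .shrink hp hs' ih
  | halve hp hs' hF _ ih => exact .halve hp hs' hF ih

theorem Path.fails_le (h : Path A B F q k s p) : k ≤ s := by
  induction h <;> omega

theorem Path.width_le (h : Path A B F q k s p) : 2 ^ s * q.width ≤ p.width := by
  induction h with
  | refl => simp
  | shrink _ hs _ ih => have := hs.half; rw [pow_succ]; linarith
  | halve _ hs _ _ ih => have := hs.half; rw [pow_succ]; linarith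

/-- Few steps are left if the width is not much larger than at the end. -/
theorem Path.length_le (h : Path A B F q k s p) {c : ℕ} (hc : (p.width : ℝ) ≤ 2 ^ c * q.width) :
    s ≤ c := by
  have h1 : (2 : ℝ) ^ s * q.width ≤ p.width := by exact_mod_cast h.width_le
  have h2 : (2 : ℝ) ^ s ≤ 2 ^ c := le_of_mul_le_mul_right (h1.trans hc) h.valid_end.width_pos
  exact (pow_le_pow_iff_right₀ (by norm_num)).1 h2

theorem Path.level_le (h : Path A B F q k s p) : p.level * 2 ^ s ≤ q.level * 4 ^ k := by
  induction h with
  | refl => simp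
  | shrink _ hs _ ih =>
    rw [hs.level_eq] at ih
    rw [pow_succ]; linarith
  | @halve k s p p' hp hs _ _ ih =>
    have h1 := hs.half_level_le hp
    have h2 : (0 : ℝ) < 2 ^ s := by positivity
    rw [pow_succ, pow_succ]
    nlinarith

/-- Quadratic steps double the level and bisections at most halve it. Since it stays between 2 and
2^M, quadratic steps outnumber bisections by at most M, and only bisections need to be counted. -/
theorem Path.length_le_fails (h : Path A B F q k s p) {M : ℕ} (hM : 2 * (A + B) ≤ 2 ^ M) :
    s ≤ M + 2 * k := by
  have h1 := h.level_le
  have h2 := h.valid_end.level_le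
  have h3 := h.valid.two_le_level
  have hM' : (2 * (A + B) : ℝ) ≤ 2 ^ M := by exact_mod_cast hM
  have h4 : (2 : ℝ) ^ s ≤ 2 ^ (M + 2 * k) := by
    calc (2 : ℝ) ^ s ≤ p.level * 2 ^ s := by
          have : (0 : ℝ) < 2 ^ s := by positivity
          nlinarith
      _ ≤ q.level * 4 ^ k := h1
      _ ≤ 2 ^ M * 4 ^ k := by gcongr; linarith
      _ = 2 ^ (M + 2 * k) := by rw [pow_add, pow_mul]; norm_num
  exact (pow_le_pow_iff_right₀ (by norm_num)).1 h4

/-- Amortized analysis of the quadratic steps if bisections take place only at widths less than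
`N_I * 2 ^ ω`: the potential `level + logWidth - ω` is kept by the quadratic steps and reduced by a
constant factor by the bisections. -/
theorem Path.fails_le_of_threshold {ω : ℝ} {K : ℕ} (G E : Active → Prop)
    (hGs : ∀ p p', Valid A B p → Shrinks p p' → G p → G p')
    (hGh : ∀ p p', Valid A B p → Halves p p' → G p → G p')
    (hexit : ∀ p k s, Path A B F q k s p → G p → (E p ∨ p.logWidth < ω + 2) → k ≤ K)
    (hfail : ∀ p, Valid A B p → p.a ≤ q.a → q.b ≤ p.b → F p → G p → ¬ E p →
      p.logWidth < p.level + ω)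
    (h : Path A B F q k s p) (hG : G p) {t : ℕ}
    (ht : p.level + (p.logWidth - ω) ≤ (4 / 3) ^ t) : k ≤ t + K := by
  induction h generalizing t with
  | refl hq => omega
  | @shrink k s p p' hp hs h' ih =>
    apply ih (hGs p p' hp hs hG)
    rw [hs.level_eq, hs.logWidth_eq hp]
    linarith
  | @halve k s p p' hp hs hF h' ih =>
    by_cases hE : E p ∨ p.logWidth < ω + 2
    · have := hexit p _ _ (.halve hp hs hF h') hG hE
      omega
    · push Not at hE
      have hc := (Path.halve hp hs hF h').contains
      have h1 := hfail p hp hc.1 hc.2 hF hG hE.1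
      -- ω + 2 ≤ W < L + ω forces L > 2, so the bisection really halves L.
      have h4 : 4 ≤ p.level := by
        rcases hp.level_cases with h2 | h4
        · linarith [hE.2]
        · exact h4
      rcases t with _ | t
      · norm_num at ht
        linarith [hE.2]
      · have := ih (hGh p p' hp hs hG) (t := t) (by
          rw [hs.level_eq hp h4, hs.logWidth_eq hp]
          rw [pow_succ] at ht
          linarith)
        omega

end Paths
section Phases

variable {A B : ℕ} {F : Active → Prop} {p p' q : Active} {k s : ℕ}

theorem Path.length_le_of_logWidth (h : Path A B F q k s p) {c : ℕ}
    (hc : p.logWidth ≤ c + q.logWidth) : s ≤ c := by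
  apply h.length_le
  have hq := h.valid_end.width_pos
  have h2 : (0 : ℝ) < 2 ^ c := by positivity
  have e : Real.logb 2 (2 ^ c * q.width) = c + q.logWidth := by
    rw [Real.logb_mul h2.ne' hq.ne', Real.logb_pow, Real.logb_self_eq_one (by norm_num), mul_one]
    rfl
  rw [← Real.logb_le_logb (b := 2) (by norm_num) h.valid.width_pos (by positivity), e]
  exact hc

theorem Inside.logWidth_le (h : Inside p' p) (hp' : Valid A B p') (hp : Valid A B p) :
    p'.logWidth ≤ p.logWidth - 1 := by
  have h1 : (2 * p'.width : ℝ) ≤ p.width := by exact_mod_cast h.half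
  have h2 := (Real.logb_le_logb (b := 2) (by norm_num)
    (mul_pos two_pos hp'.width_pos) hp.width_pos).2 h1
  rw [Real.logb_mul (by norm_num) hp'.width_pos.ne', Real.logb_self_eq_one (by norm_num)] at h2
  have h3 : p'.logWidth = Real.logb 2 p'.width := rfl
  have h4 : p.logWidth = Real.logb 2 p.width := rfl
  linarith

theorem Valid.potential_le (hp : Valid A B p) {ω : ℝ} (hω : -(B : ℝ) ≤ ω) {t : ℕ}
    (ht : 3 * (A + B : ℝ) ≤ (4 / 3) ^ t) : p.level + (p.logWidth - ω) ≤ (4 / 3) ^ t := by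
  have := hp.level_le
  have := hp.upper
  linarith

/-- The steps that do not move an endpoint of the interval. -/
theorem Path.fails_le_of_endpoint {ω : ℝ} {K t : ℕ} (G H : Active → Prop)
    (hG : ∀ p p', Inside p' p → G p → G p')
    (hω : -(B : ℝ) ≤ ω)
    (hH : ∀ p, Valid A B p → p.a ≤ q.a → q.b ≤ p.b → H p → ω ≤ p.logWidth)
    (hfail : ∀ p, Valid A B p → p.a ≤ q.a → q.b ≤ p.b → F p → H p → p.logWidth < p.level + ω)
    (hnext : ∀ p k s, Path A B F q k s p → G p → ¬ H p → k ≤ K)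
    (ht : 3 * (A + B : ℝ) ≤ (4 / 3) ^ t)
    (h : Path A B F q k s p) (hGp : G p) : k ≤ t + (2 + K) := by
  -- Each step lowers W by at least 1, while `H` forces W ≥ ω; below ω + j the phase ends within j
  -- steps.
  have aux : ∀ p k s, Path A B F q k s p → G p → ∀ j : ℕ, p.logWidth < ω + j → k ≤ j + K := by
    intro p k s h
    induction h with
    | refl => intro _ j _; omega
    | @shrink k s p p' hp hs h' ih =>
      intro hGp j hj
      by_cases hHp : H p
      · rcases j with _ | j
        · have hc := (Path.shrink hp hs h').contains
          have := hH p hp hc.1 hc.2 hHp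
          simp at hj; linarith
        · have := ih (hG _ _ hs.toInside hGp) j (by
            have := hs.toInside.logWidth_le h'.valid hp
            push_cast at hj
            linarith)
          omega
      · have := hnext p _ _ (.shrink hp hs h') hGp hHp
        omega
    | @halve k s p p' hp hs hF h' ih =>
      intro hGp j hj
      by_cases hHp : H p
      · rcases j with _ | j
        · have hc := (Path.halve hp hs hF h').contains
          have := hH p hp hc.1 hc.2 hHp
          simp at hj; linarith
        · have := ih (hG _ _ hs.toInside hGp) j (by
            have := hs.toInside.logWidth_le h'.valid hp
            push_cast at hj
            linarith)
          omega
      · have := hnext p _ _ (.halve hp hs hF h') hGp hHp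
        omega
  refine h.fails_le_of_threshold G (fun p => ¬ H p)
    (fun p p' _ hs hg => hG p p' hs.toInside hg) (fun p p' _ hs hg => hG p p' hs.toInside hg)
    ?_ ?_ hGp (h.valid.potential_le hω ht)
  · rintro p k s hp hg (hHp | hw)
    · have := hnext p k s hp hg hHp
      omega
    · exact aux p k s hp hg 2 (by exact_mod_cast hw)
  · intro p hp h1 h2 hF _ hHp
    exact hfail p hp h1 h2 hF (not_not.1 hHp)

/-- The steps until the interval is far from the endpoints `a` and `b`. -/
theorem Path.fails_le_of_moved {a b : ℚ} {J K : ℕ}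
    (hnext : ∀ p k s, Path A B F q k s p → a + 2 ^ J / 4 * p.width ≤ p.a →
      p.b + 2 ^ J / 4 * p.width ≤ b → k ≤ K)
    (h : Path A B F q k s p) (i j : ℕ) (hij : i + j = J) (ha : a + 2 ^ j / 4 * p.width ≤ p.a)
    (hb : p.b + 2 ^ j / 4 * p.width ≤ b) : k ≤ i + K := by
  -- A step at least halves the width and does not approach a or b, so the guaranteed ratio of
  -- distance to width doubles.
  have step : ∀ (p p' : Active) (j : ℕ), Inside p' p → a + 2 ^ j / 4 * p.width ≤ p.a →
      p.b + 2 ^ j / 4 * p.width ≤ b →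
      a + 2 ^ (j + 1) / 4 * p'.width ≤ p'.a ∧ p'.b + 2 ^ (j + 1) / 4 * p'.width ≤ b := by
    intro p p' j hs ha hb
    have h1 : (2 : ℚ) ^ j / 4 * (2 * p'.width) ≤ 2 ^ j / 4 * p.width := by
      gcongr
      exact hs.half
    have h2 := hs.left_le
    have h3 := hs.le_right
    rw [pow_succ]
    constructor <;> linarith
  induction h generalizing i j with
  | refl => omega
  | @shrink k s p p' hp hs h' ih =>
    rcases i with _ | i
    · have := hnext p _ _ (.shrink hp hs h') (by rw [← hij, zero_add]; exact ha)
        (by rw [← hij, zero_add]; exact hb)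
      omega
    · obtain ⟨h1, h2⟩ := step p p' j hs.toInside ha hb
      have := ih i (j + 1) (by omega) h1 h2
      omega
  | @halve k s p p' hp hs hF h' ih =>
    rcases i with _ | i
    · have := hnext p _ _ (.halve hp hs hF h') (by rw [← hij, zero_add]; exact ha)
        (by rw [← hij, zero_add]; exact hb)
      omega
    · obtain ⟨h1, h2⟩ := step p p' j hs.toInside ha hb
      have := ih i (j + 1) (by omega) h1 h2
      omega

/-- The steps until `N_I` is small compared to the distance `2 ^ r` from the roots outside of the
cluster. -/
theorem Path.fails_le_of_logWidth_le {a b : ℚ} {r : ℝ} {K : ℕ}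
    (hnext : ∀ p k s, Path A B F q k s p → a ≤ p.a → p.b ≤ b → p.level + p.logWidth ≤ r → k ≤ K)
    (h : Path A B F q k s p) (ha : a ≤ p.a) (hb : p.b ≤ b) (hr : p.logWidth + 2 ≤ r) {t : ℕ}
    (ht : p.level + p.logWidth - r ≤ (4 / 3) ^ t) : k ≤ t + 1 + K := by
  induction h generalizing t with
  | refl => omega
  | @shrink k s p p' hp hs h' ih =>
    have := hs.level_eq
    have := hs.logWidth_eq hp
    have := hp.two_le_level
    exact ih (ha.trans hs.left_le) (hs.le_right.trans hb) (by linarith) (by linarith)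
  | @halve k s p p' hp hs hF h' ih =>
    by_cases hc : p.level + p.logWidth ≤ r
    · have := hnext p _ _ (.halve hp hs hF h') ha hb hc
      omega
    · push Not at hc
      -- W + 2 ≤ r < L + W gives L > 2.
      have h4 : 4 ≤ p.level := by
        rcases hp.level_cases with h2 | h4
        · linarith
        · exact h4
      have h5 := hs.level_eq hp h4
      have h6 := hs.logWidth_eq hp
      have ha' := ha.trans hs.left_le
      have hb' := hs.le_right.trans hb
      rcases t with _ | t
      · rw [pow_zero] at ht
        -- Here L + W - r ≤ 1 and L ≥ 4, so a single bisection brings L + W below r.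
        have := hnext p' _ _ h' ha' hb' (by linarith)
        omega
      · have h7 : (0 : ℝ) < (4 / 3) ^ t := by positivity
        have := ih ha' hb' (by linarith) (t := t) (by rw [pow_succ] at ht; linarith)
        omega

/-- The steps that approach a cluster of roots. -/
theorem Path.fails_le_of_cluster {a b : ℚ} {r ω : ℝ} {t c : ℕ}
    (hω : q.logWidth ≤ ω) (hc : ω + 2 ≤ c + q.logWidth)
    (hfail : ∀ p, Valid A B p → p.a ≤ q.a → q.b ≤ p.b → F p → a ≤ p.a → p.b ≤ b →
      p.level + p.logWidth ≤ r → p.logWidth < p.level + ω)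
    (ht : 3 * (A + B : ℝ) ≤ (4 / 3) ^ t)
    (h : Path A B F q k s p) (ha : a ≤ p.a) (hb : p.b ≤ b) (hr : p.level + p.logWidth ≤ r) :
    k ≤ t + c := by
  refine h.fails_le_of_threshold (fun p => a ≤ p.a ∧ p.b ≤ b ∧ p.level + p.logWidth ≤ r)
    (fun _ => False) (ω := ω) ?_ ?_ ?_ ?_ ⟨ha, hb, hr⟩
    (h.valid.potential_le (h.valid_end.lower.trans hω) ht)
  · rintro p p' hp hs ⟨h1, h2, h3⟩
    refine ⟨h1.trans hs.left_le, hs.le_right.trans h2, ?_⟩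
    rw [hs.level_eq, hs.logWidth_eq hp]; linarith
  · rintro p p' hp hs ⟨h1, h2, h3⟩
    refine ⟨h1.trans hs.left_le, hs.le_right.trans h2, ?_⟩
    rw [hs.logWidth_eq hp]
    rcases hp.level_cases with h | h
    · rw [hs.level_eq_two hp h]; linarith
    · rw [hs.level_eq hp h]; linarith
  · rintro p k s hp - (h | h)
    · exact h.elim
    · exact hp.fails_le.trans (hp.length_le_of_logWidth (by linarith))
  · rintro p hp h1 h2 hF ⟨h3, h4, h5⟩ -
    exact hfail p hp h1 h2 hF h3 h4 h5

theorem Valid.mul_le_width (hp : Valid A B p) {x : ℝ} (hx : 0 < x)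
    (h : ¬ p.logWidth < p.level + Real.logb 2 x) : p.N * x ≤ p.width := by
  rw [not_lt, Active.level, ← Real.logb_mul hp.N_pos.ne' hx.ne', Active.logWidth,
    Real.logb_le_logb (by norm_num) (mul_pos hp.N_pos hx) hp.width_pos] at h
  exact h

theorem Valid.logb_le (hp : Valid A B p) {x : ℝ} (hx : (p.width : ℝ) ≤ x) :
    p.logWidth ≤ Real.logb 2 x :=
  (Real.logb_le_logb (by norm_num) hp.width_pos (hp.width_pos.trans_le hx)).2 hx

end Phases

/-! ### Bisections along a path of constant variation count. -/

/-- None of the quadratic steps of Dsc² succeeds at `p`. -/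
structure Fails (f : ℤ[X]) (v : ℕ) (p : Active) : Prop where
  var_eq : p.var f = v
  leftmost_ne : p.leftmost.var f ≠ v
  rightmost_ne : p.rightmost.var f ≠ v
  newton_left_ne : (p.newtonInterval (newton f v p.a)).var f ≠ v
  newton_right_ne : (p.newtonInterval (newton f v p.b)).var f ≠ v

/-- By monotonicity, every test interval that contains the end q of the path succeeds. -/
theorem var_eq_of_between {f : ℤ[X]} {v : ℕ} {p p' q : Active} (hp : p.var f = v)
    (hq : q.var f = v) (hq0 : 0 < q.width) (h1 : p.a ≤ p'.a) (h2 : p'.a ≤ q.a) (h3 : q.b ≤ p'.b)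
    (h4 : p'.b ≤ p.b) : p'.var f = v := by
  have hq1 : q.a < q.b := by rw [Active.width] at hq0; linarith
  have e1 : q.var f ≤ p'.var f := var_mono f h2 hq1 h3
  have e2 : p'.var f ≤ p.var f := var_mono f h1 (by linarith) h4
  omega

theorem newtonInterval_subset (p : Active) (hN : 4 ≤ p.N) (hw : 0 < p.width) (l : ℚ) :
    p.a ≤ (p.newtonInterval l).a ∧ (p.newtonInterval l).b ≤ p.b := by
  have hN0 : (0 : ℚ) < p.N := by exact_mod_cast (by omega : 0 < p.N)
  obtain ⟨h1, h2⟩ := gridIndex_bounds p hN l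
  have h1' : (2 : ℚ) ≤ p.gridIndex l := by exact_mod_cast h1
  have h2' : (p.gridIndex l : ℚ) ≤ 4 * p.N - 2 := by exact_mod_cast h2
  set h := p.width / (4 * p.N) with hh
  have hh0 : 0 < h := by positivity
  have hwh : p.b - p.a = 4 * p.N * h := by
    rw [hh, Active.width]; field_simp
  simp only [Active.newtonInterval, ← hh]
  constructor <;> nlinarith

/-- Otherwise B₁ would reach beyond the right end of q, hence contain q and pass its test. -/
theorem Fails.logWidth_lt_of_left {A B : ℕ} {f : ℤ[X]} {v : ℕ} {p q : Active}
    (hF : Fails f v p) (hp : Valid A B p) (hq : q.var f = v) (hq0 : 0 < q.width)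
    (h1 : p.a ≤ q.a) :
    p.logWidth < p.level + Real.logb 2 ((q.b : ℝ) - p.a) := by
  by_contra h
  have hq0' : 0 < q.b - q.a := hq0
  have hx : 0 < q.b - p.a := by linarith
  have hx' : (0 : ℝ) < q.b - p.a := by exact_mod_cast hx
  have h3 := hp.mul_le_width hx' h
  have h4 : p.N * (q.b - p.a) ≤ p.width := by exact_mod_cast h3
  have hN : (0 : ℚ) < p.N := by exact_mod_cast hp.N_pos
  have h5 : q.b - p.a ≤ p.width / p.N := by rw [le_div_iff₀ hN]; linarith
  have hN4 : (4 : ℚ) ≤ p.N := by exact_mod_cast hp.four_le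
  have h6 : p.width / p.N ≤ p.width := div_le_self hp.pos.le (by linarith)
  refine hF.leftmost_ne (var_eq_of_between hF.var_eq hq hq0 le_rfl h1 ?_ ?_)
  · simp only [Active.leftmost]; linarith
  · simp only [Active.leftmost]
    have : p.width = p.b - p.a := rfl
    linarith

theorem Fails.logWidth_lt_of_right {A B : ℕ} {f : ℤ[X]} {v : ℕ} {p q : Active}
    (hF : Fails f v p) (hp : Valid A B p) (hq : q.var f = v) (hq0 : 0 < q.width)
    (h2 : q.b ≤ p.b) :
    p.logWidth < p.level + Real.logb 2 ((p.b : ℝ) - q.a) := by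
  by_contra h
  have hq0' : 0 < q.b - q.a := hq0
  have hx : 0 < p.b - q.a := by linarith
  have hx' : (0 : ℝ) < p.b - q.a := by exact_mod_cast hx
  have h3 := hp.mul_le_width hx' h
  have h4 : p.N * (p.b - q.a) ≤ p.width := by exact_mod_cast h3
  have hN : (0 : ℚ) < p.N := by exact_mod_cast hp.N_pos
  have h5 : p.b - q.a ≤ p.width / p.N := by rw [le_div_iff₀ hN]; linarith
  have hN4 : (4 : ℚ) ≤ p.N := by exact_mod_cast hp.four_le
  have h6 : p.width / p.N ≤ p.width := div_le_self hp.pos.le (by linarith)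
  refine hF.rightmost_ne (var_eq_of_between hF.var_eq hq hq0 ?_ ?_ h2 le_rfl)
  · simp only [Active.rightmost]
    have : p.width = p.b - p.a := rfl
    linarith
  · simp only [Active.rightmost]; linarith

/-- At least v roots are close to q by `var_le_card`. As p is deep inside (a, b), `card_near_le_var`
allows at most v roots near p. So the roots near q are exactly v, and no other root comes within R
of p. Newton tests then fail only while N w is still too large for R, or once w is less than N times
the cluster scale. -/
theorem fails_le_of_deep {A B : ℕ} {f : ℤ[X]} (hf : Squarefree (f.map (Int.castRingHom ℚ)))
    (hn : 1 ≤ f.natDegree) {v : ℕ} (hv : 1 ≤ v) {a b : ℚ} (hab : a < b) (hvar : var f a b = v)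
    {q : Active} (hq : q.var f = v) {t J c : ℕ} (ht : 3 * (A + B : ℝ) ≤ (4 / 3) ^ t)
    (hJ : 512 * (f.natDegree * (f.natDegree + 2)) ≤ 2 ^ J) (hc : 256 * (f.natDegree + 2) ≤ 2 ^ c)
    {k s : ℕ} {p : Active} (h : Path A B (Fails f v) q k s p)
    (ha : a + 2 ^ J / 4 * p.width ≤ p.a) (hb : p.b + 2 ^ J / 4 * p.width ≤ b) :
    k ≤ t + 1 + (t + c) := by
  have hf0 : f ≠ 0 := by rintro rfl; simp at hf
  have hn' : (1 : ℝ) ≤ f.natDegree := by exact_mod_cast hn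
  have hpv := h.valid
  have hqv := h.valid_end
  have hqw := hqv.width_pos
  have hpw := hpv.width_pos
  have hqab : (q.width : ℝ) = q.b - q.a := by rw [Active.width]; push_cast; rfl
  have hqlt : q.a < q.b := by have := hqv.pos; rw [Active.width] at this; linarith
  set n := (f.natDegree : ℝ) with hndef
  have hJ' : 128 * (n * (n + 2)) ≤ 2 ^ J / 4 := by
    have : (512 * (n * (n + 2)) : ℝ) ≤ 2 ^ J := by rw [hndef]; exact_mod_cast hJ
    linarith
  set ρ : ℝ := 2 ^ J / 4 * p.width with hρ
  have hρ0 : 0 < ρ := by positivity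
  -- 128 = 2 · 16 · 4 is chosen so that R/(16n) ≥ 4 w(p), that is, W + 2 ≤ r below.
  have hρw : 128 * (n * (n + 2)) * p.width ≤ ρ := by rw [hρ]; gcongr
  have ha' : a + ρ ≤ p.a := by
    have := (Rat.cast_le (K := ℝ)).2 ha
    push_cast at this
    exact this
  have hb' : p.b + ρ ≤ b := by
    have := (Rat.cast_le (K := ℝ)).2 hb
    push_cast at this
    exact this
  have hqp : (q.width : ℝ) ≤ p.width := by
    have h1 := h.contains
    have : q.width ≤ p.width := by rw [Active.width, Active.width]; linarith [h1.1, h1.2]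
    exact_mod_cast this
  set R := ρ / (2 * (n + 2)) with hR
  have hR0 : 0 < R := by positivity
  set Z := (complexRoots f).filter fun y : ℂ => ‖y - q.a‖ < (n + 2) * ((q.b : ℝ) - q.a) with hZ
  have hvZ : v ≤ Z.card := by rw [← hq]; exact var_le_card hf hqlt
  have hZnear : ∀ y ∈ Z, aeval y f = 0 ∧ ∃ t : ℝ, a + ρ ≤ t ∧ t + ρ ≤ b ∧
      2 * (n + 2) * ‖y - t‖ ≤ ρ := by
    intro y hy
    obtain ⟨h1, h2⟩ := Finset.mem_filter.1 hy
    have h3 : (p.a : ℝ) ≤ q.a := by exact_mod_cast h.contains.1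
    have h4 : (q.a : ℝ) ≤ p.b := by exact_mod_cast hqlt.le.trans h.contains.2
    refine ⟨(mem_complexRoots hf0).1 h1, q.a, by linarith, by linarith, ?_⟩
    rw [← hqab] at h2
    have h5 : ‖y - ((q.a : ℝ) : ℂ)‖ = ‖y - (q.a : ℂ)‖ := by norm_num
    rw [h5]
    calc 2 * (n + 2) * ‖y - q.a‖ ≤ 2 * (n + 2) * ((n + 2) * q.width) := by gcongr
      _ ≤ 2 * (n + 2) * ((n + 2) * p.width) := by gcongr
      _ = 2 * ((n + 2) * (n + 2)) * p.width := by ring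
      _ ≤ 128 * (n * (n + 2)) * p.width := by
        apply mul_le_mul_of_nonneg_right _ hpw.le
        nlinarith
      _ ≤ ρ := hρw
  have hZcard : Z.card = v := by
    refine le_antisymm ?_ hvZ
    rw [← hvar]
    exact card_near_le_var hf0 hab hρ0 Z hZnear
  have hfar : ∀ y ∈ complexRoots f, ¬ ‖y - q.a‖ < (n + 2) * ((q.b : ℝ) - q.a) →
      ∀ t : ℚ, p.a ≤ t → t ≤ p.b → R ≤ ‖y - t‖ := by
    intro y hy hyZ t ht1 ht2
    by_contra hlt
    push Not at hlt
    have hyZ' : y ∉ Z := by rw [hZ, Finset.mem_filter, not_and]; exact fun _ => hyZ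
    have h1 : (insert y Z).card ≤ v := by
      rw [← hvar]
      apply card_near_le_var hf0 hab hρ0
      intro x hx
      rcases Finset.mem_insert.1 hx with rfl | hx
      · have h3 : (p.a : ℝ) ≤ t := by exact_mod_cast ht1
        have h4 : (t : ℝ) ≤ p.b := by exact_mod_cast ht2
        refine ⟨(mem_complexRoots hf0).1 hy, t, by linarith, by linarith, ?_⟩
        have h5 : ‖x - ((t : ℝ) : ℂ)‖ = ‖x - (t : ℂ)‖ := by norm_num
        rw [h5, ← hndef]
        rw [hR, lt_div_iff₀ (by positivity)] at hlt
        linarith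
      · exact hZnear x hx
    rw [Finset.card_insert_of_notMem hyZ'] at h1
    omega
  -- r and ω are the logarithmic forms of the two size hypotheses of
  -- `exists_newtonInterval_contains`: L + W ≤ r and L + ω ≤ W.
  set r := Real.logb 2 (R / (16 * n)) with hr
  set ω := Real.logb 2 (64 * (n + 2) * ((q.b : ℝ) - q.a)) with hω
  have hωq : ω = Real.logb 2 (64 * (n + 2)) + q.logWidth := by
    rw [hω, ← hqab, Real.logb_mul (by positivity) hqw.ne']; rfl
  have hpr : p.logWidth + 2 ≤ r := by
    have e : p.logWidth + 2 = Real.logb 2 (p.width * 2 ^ 2) := by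
      rw [Real.logb_mul hpw.ne' (by norm_num), Real.logb_pow, Real.logb_self_eq_one (by norm_num)]
      rw [Active.logWidth]; norm_num
    rw [e, hr]
    apply (Real.logb_le_logb (by norm_num) (by positivity) (by positivity)).2
    rw [hR, le_div_iff₀ (by positivity), le_div_iff₀ (by positivity)]
    linarith
  refine h.fails_le_of_logWidth_le (a := p.a) (b := p.b) (r := r) ?_ le_rfl le_rfl hpr ?_
  · intro p' k s h' h1 h2 h3
    refine h'.fails_le_of_cluster (a := p.a) (b := p.b) (r := r) (ω := ω) ?_ ?_ ?_ ht h1 h2 h3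
    · rw [hωq]
      have : 0 ≤ Real.logb 2 (64 * (n + 2)) := Real.logb_nonneg (by norm_num) (by linarith)
      linarith
    · have hc' : (256 * (n + 2) : ℝ) ≤ 2 ^ c := by rw [hndef]; exact_mod_cast hc
      have e : Real.logb 2 (64 * (n + 2)) + 2 = Real.logb 2 (64 * (n + 2) * 2 ^ 2) := by
        rw [Real.logb_mul (x := 64 * (n + 2)) (by positivity) (by norm_num), Real.logb_pow,
          Real.logb_self_eq_one (by norm_num)]
        norm_num
      have e2 : Real.logb 2 (64 * (n + 2) * 2 ^ 2) ≤ Real.logb 2 (2 ^ c) :=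
        (Real.logb_le_logb (by norm_num) (by positivity) (by positivity)).2 (by linarith)
      rw [Real.logb_pow, Real.logb_self_eq_one (by norm_num), mul_one] at e2
      linarith
    · intro x hx hx1 hx2 hF hx3 hx4 hx5
      by_contra hcon
      have hw := hx.mul_le_width (x := 64 * (n + 2) * ((q.b : ℝ) - q.a))
        (by rw [← hqab]; positivity) hcon
      have hRx : 16 * n * (x.N * (x.width : ℝ)) ≤ R := by
        have h0 : 0 < (x.N : ℝ) * x.width := mul_pos hx.N_pos hx.width_pos
        rw [Active.level, Active.logWidth,
          ← Real.logb_mul hx.N_pos.ne' hx.width_pos.ne', hr,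
          Real.logb_le_logb (by norm_num) h0 (by positivity), le_div_iff₀ (by positivity)] at hx5
        linarith
      obtain ⟨e, he, he1, he2⟩ := exists_newtonInterval_contains hf hn hv hx.four_le hx1 hqlt hx2
        hRx hw hZcard (fun y hy hyZ t ht1 ht2 =>
          hfar y hy hyZ t (hx3.trans ht1) (ht2.trans hx4))
      obtain ⟨i1, i2⟩ := newtonInterval_subset x hx.four_le hx.pos (newton f v e)
      have hsucc := var_eq_of_between hF.var_eq hq hqv.pos i1 he1 he2 i2
      rcases he with rfl | rfl
      · exact hF.newton_left_ne hsucc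
      · exact hF.newton_right_ne hsucc
  · have := hpv.level_le
    have := h.valid.lower
    have : (0 : ℝ) ≤ A + B := by positivity
    linarith

/-- The number of bisections on a path along which the number of sign variations is constant. -/
theorem fails_le_of_path {A B : ℕ} {f : ℤ[X]} (hf : Squarefree (f.map (Int.castRingHom ℚ)))
    (hn : 1 ≤ f.natDegree) {v : ℕ} (hv : 1 ≤ v) {q : Active} (hq : q.var f = v) {t J c : ℕ}
    (ht : 3 * (A + B : ℝ) ≤ (4 / 3) ^ t)
    (hJ : 512 * (f.natDegree * (f.natDegree + 2)) ≤ 2 ^ J) (hc : 256 * (f.natDegree + 2) ≤ 2 ^ c)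
    {k s : ℕ} {p : Active} (hp : p.var f = v) (h : Path A B (Fails f v) q k s p) :
    k ≤ 4 * t + J + c + 5 := by
  have hqv := h.valid_end
  have hqlt : q.a < q.b := by have := hqv.pos; rw [Active.width] at this; linarith
  have hplt : p.a < p.b := by have := h.valid.pos; rw [Active.width] at this; linarith
  have hqab : (q.width : ℝ) = q.b - q.a := by rw [Active.width]; push_cast; rfl
  have hqa : (p.a : ℝ) ≤ q.a := by exact_mod_cast h.contains.1
  have hqb : (q.b : ℝ) ≤ p.b := by exact_mod_cast h.contains.2
  -- The phases are treated in reverse order: both endpoints have moved, then only the left one,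
  -- then neither.
  have moved : ∀ x k s, Path A B (Fails f v) q k s x → p.a + x.width / 4 ≤ x.a →
      x.b + x.width / 4 ≤ p.b → k ≤ J + (t + 1 + (t + c)) := by
    intro x k s hx h1 h2
    refine hx.fails_le_of_moved (a := p.a) (b := p.b) (J := J) ?_ J 0 (by omega) ?_ ?_
    · intro y k s hy h3 h4
      exact fails_le_of_deep hf hn hv hplt hp hq ht hJ hc hy h3 h4
    · rw [pow_zero]; linarith
    · rw [pow_zero]; linarith
  have right : ∀ x k s, Path A B (Fails f v) q k s x → p.a + x.width / 4 ≤ x.a →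
      (x.b = p.b ∨ x.b + x.width / 4 ≤ p.b) → k ≤ t + (2 + (J + (t + 1 + (t + c)))) := by
    intro x k s hx h1 h2
    refine hx.fails_le_of_endpoint
      (fun y => p.a + y.width / 4 ≤ y.a ∧ (y.b = p.b ∨ y.b + y.width / 4 ≤ p.b))
      -- While the right endpoint is fixed, the interval contains (q.a, p.b), so W ≥ ω, and failure
      -- of the test of B₂ gives W < L + ω.
      (fun y => y.b = p.b) (ω := Real.logb 2 ((p.b : ℝ) - q.a)) ?_ ?_ ?_ ?_ ?_ ht ⟨h1, h2⟩
    · rintro y z hz ⟨h3, h4⟩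
      have e1 := hz.half
      have e2 := hz.left_le
      have e3 := hz.le_right
      have e4 := hz.pos
      refine ⟨by linarith, ?_⟩
      rcases h4 with h4 | h4
      · rw [← h4]; exact hz.right
      · right; linarith
    · exact hqv.lower.trans (hqv.logb_le (by linarith))
    · rintro y hy h3 h4 h5
      apply (Real.logb_le_logb (by norm_num) (by linarith [hqv.width_pos]) hy.width_pos).2
      have e : (y.width : ℝ) = y.b - y.a := by rw [Active.width]; push_cast; rfl
      have e2 : (y.a : ℝ) ≤ q.a := by exact_mod_cast h3
      rw [e, h5]; linarith
    · rintro y hy h3 h4 hF h5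
      have := hF.logWidth_lt_of_right hy hq hqv.pos h4
      rwa [h5] at this
    · rintro y k s hy ⟨h3, h4⟩ h5
      exact moved y k s hy h3 (h4.resolve_left h5)
  have left : k ≤ t + (2 + (t + (2 + (J + (t + 1 + (t + c)))))) := by
    refine h.fails_le_of_endpoint
      (fun y => (y.a = p.a ∨ p.a + y.width / 4 ≤ y.a) ∧
        (y.b = p.b ∨ y.b + y.width / 4 ≤ p.b))
      (fun y => y.a = p.a) (ω := Real.logb 2 ((q.b : ℝ) - p.a)) ?_ ?_ ?_ ?_ ?_ ht
      ⟨Or.inl rfl, Or.inl rfl⟩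
    · rintro y z hz ⟨h3, h4⟩
      have e1 := hz.half
      have e2 := hz.left_le
      have e3 := hz.le_right
      have e4 := hz.pos
      constructor
      · rcases h3 with h3 | h3
        · rw [← h3]; exact hz.left
        · right; linarith
      · rcases h4 with h4 | h4
        · rw [← h4]; exact hz.right
        · right; linarith
    · exact hqv.lower.trans (hqv.logb_le (by linarith))
    · rintro y hy h3 h4 h5
      apply (Real.logb_le_logb (by norm_num) (by linarith [hqv.width_pos]) hy.width_pos).2
      have e : (y.width : ℝ) = y.b - y.a := by rw [Active.width]; push_cast; rfl
      have e2 : (q.b : ℝ) ≤ y.b := by exact_mod_cast h4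
      rw [e, h5]; linarith
    · rintro y hy h3 h4 hF h5
      have := hF.logWidth_lt_of_left hy hq hqv.pos h3
      rwa [h5] at this
    · rintro y k s hy ⟨h3, h4⟩ h5
      exact right y k s hy (h3.resolve_left h5) h4
  omega

/-! ### Children and the size of the recursion tree. -/

section Children

variable {A B : ℕ} {f : ℤ[X]} {p p' : Active}

theorem shrinks_leftmost (hN : 4 ≤ p.N) (hw : 0 < p.width) : Shrinks p p.leftmost := by
  have hN' : (4 : ℚ) ≤ p.N := by exact_mod_cast hN
  have e : p.leftmost.width = p.width / p.N := by simp [Active.leftmost, Active.width]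
  have h0 : 0 < p.width / p.N := by positivity
  have h4 : 4 * (p.width / p.N) ≤ p.width := by
    calc 4 * (p.width / p.N) ≤ p.N * (p.width / p.N) := by gcongr
      _ = p.width := by field_simp
  have hb : p.leftmost.b = p.a + p.width / p.N := rfl
  have hwd : p.width = p.b - p.a := rfl
  refine { pos := by rwa [e], left_le := le_rfl, le_right := ?_, half := ?_, left := Or.inl rfl,
           right := Or.inr ?_, N_eq := rfl, width_eq := e }
  · rw [hb]; linarith
  · rw [e]; linarith
  · rw [hb, e]; linarith

theorem shrinks_rightmost (hN : 4 ≤ p.N) (hw : 0 < p.width) : Shrinks p p.rightmost := by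
  have hN' : (4 : ℚ) ≤ p.N := by exact_mod_cast hN
  have e : p.rightmost.width = p.width / p.N := by simp [Active.rightmost, Active.width]
  have h0 : 0 < p.width / p.N := by positivity
  have h4 : 4 * (p.width / p.N) ≤ p.width := by
    calc 4 * (p.width / p.N) ≤ p.N * (p.width / p.N) := by gcongr
      _ = p.width := by field_simp
  have ha : p.rightmost.a = p.b - p.width / p.N := rfl
  have hwd : p.width = p.b - p.a := rfl
  refine { pos := by rwa [e], left_le := ?_, le_right := le_rfl, half := ?_, left := Or.inr ?_,
           right := Or.inl rfl, N_eq := rfl, width_eq := e }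
  · rw [ha]; linarith
  · rw [e]; linarith
  · rw [ha, e]; linarith

/-- The endpoints lie on a grid whose mesh w/(4N) is a quarter of the new width. So each endpoint
either stays or moves by at least that quarter, the dichotomy on which the phases rest. -/
theorem shrinks_newtonInterval (hN : 4 ≤ p.N) (hw : 0 < p.width) (l : ℚ) :
    Shrinks p (p.newtonInterval l) := by
  have hN' : (4 : ℚ) ≤ p.N := by exact_mod_cast hN
  set h := p.width / (4 * p.N) with hh
  have hh0 : 0 < h := by positivity
  have hwN : p.width / p.N = 4 * h := by rw [hh]; field_simp
  have hwh : p.width = 4 * p.N * h := by rw [hh]; field_simp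
  have ha : (p.newtonInterval l).a = p.a + ((p.gridIndex l : ℚ) - 2) * h := rfl
  have hb : (p.newtonInterval l).b = p.a + ((p.gridIndex l : ℚ) + 2) * h := rfl
  have e : (p.newtonInterval l).width = 4 * h := by
    rw [Active.width, ha, hb]; ring
  have hsub := newtonInterval_subset p hN hw l
  have hwd : p.width = p.b - p.a := rfl
  obtain ⟨g1, g2⟩ := gridIndex_bounds p hN l
  refine { pos := by rw [e]; linarith, left_le := hsub.1, le_right := hsub.2, half := ?_,
           left := ?_, right := ?_, N_eq := rfl, width_eq := by rw [e, hwN] }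
  · rw [e, hwh]; nlinarith
  · rcases eq_or_lt_of_le g1 with g | g
    · left
      rw [ha, ← g]; push_cast; ring
    · right
      have : (3 : ℚ) ≤ p.gridIndex l := by exact_mod_cast g
      rw [ha, e]; nlinarith
  · rcases eq_or_lt_of_le g2 with g | g
    · left
      have : (p.gridIndex l : ℚ) = 4 * p.N - 2 := by rw [g]; push_cast; ring
      rw [hb, this]; linarith
    · right
      have : (p.gridIndex l : ℚ) + 1 ≤ 4 * p.N - 2 := by exact_mod_cast g
      have hb' : p.b = p.a + 4 * p.N * h := by linarith
      rw [hb, e, hb']; nlinarith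

theorem halves_leftHalf (hw : 0 < p.width) : Halves p p.leftHalf := by
  have hwd : p.width = p.b - p.a := rfl
  have hb : p.leftHalf.b = (p.a + p.b) / 2 := rfl
  have e : p.leftHalf.width = p.width / 2 := by
    simp only [Active.leftHalf, Active.width]; ring
  refine { pos := by rw [e]; linarith, left_le := le_rfl, le_right := ?_, half := ?_,
           left := Or.inl rfl, right := Or.inr ?_, N_eq := rfl, width_eq := e }
  · rw [hb]; linarith
  · rw [e]; linarith
  · rw [hb, e]; linarith

theorem halves_rightHalf (hw : 0 < p.width) : Halves p p.rightHalf := by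
  have hwd : p.width = p.b - p.a := rfl
  have ha : p.rightHalf.a = (p.a + p.b) / 2 := rfl
  have e : p.rightHalf.width = p.width / 2 := by
    simp only [Active.rightHalf, Active.width]; ring
  refine { pos := by rw [e]; linarith, left_le := ?_, le_right := le_rfl, half := ?_,
           left := Or.inr ?_, right := Or.inl rfl, N_eq := rfl, width_eq := e }
  · rw [ha]; linarith
  · rw [e]; linarith
  · rw [ha, e]; linarith

theorem children_of_var_le_one (h : p.var f ≤ 1) : children f p = [] := by
  simp [children, h]

theorem children_cases (hN : 4 ≤ p.N) (hw : 0 < p.width) {v : ℕ} (hv : p.var f = v)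
    (h2 : 2 ≤ v) :
    (∃ p', children f p = [p'] ∧ p'.var f = v ∧ Shrinks p p') ∨
      (children f p = [p.leftHalf, p.rightHalf] ∧ Fails f v p) := by
  have h1 : ¬ v ≤ 1 := by omega
  unfold children
  simp only [hv, if_neg h1]
  split_ifs with c1 c2 c3 c4
  · exact Or.inl ⟨_, rfl, c1, shrinks_leftmost hN hw⟩
  · exact Or.inl ⟨_, rfl, c2, shrinks_rightmost hN hw⟩
  · exact Or.inl ⟨_, rfl, c3, shrinks_newtonInterval hN hw _⟩
  · exact Or.inl ⟨_, rfl, c4, shrinks_newtonInterval hN hw _⟩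
  · exact Or.inr ⟨rfl, ⟨hv, c1, c2, c3, c4⟩⟩

/-- The old level is the drop of the logarithmic width, at most A + B; the new level is twice that.
-/
theorem Shrinks.valid (h : Shrinks p p') (hp : Valid A B p) (hl : -(B : ℝ) ≤ p'.logWidth) :
    Valid A B p' := by
  have h1 := h.logWidth_eq hp
  have h2 := hp.upper
  have h3 := hp.two_le_level
  obtain ⟨m, hm⟩ := hp.form
  refine ⟨⟨m + 1, ?_⟩, h.pos, hl, by linarith, ?_⟩
  · rw [h.N_eq, hm, ← pow_mul, ← pow_succ]
  · rw [h.level_eq]; linarith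

theorem Halves.valid (h : Halves p p') (hp : Valid A B p) (hl : -(B : ℝ) ≤ p'.logWidth) :
    Valid A B p' := by
  have h1 := h.logWidth_eq hp
  have h2 := hp.upper
  have h3 := hp.level_le
  obtain ⟨m, hm⟩ := hp.form
  refine ⟨⟨m - 1, h.N_eq_of_form hm⟩, h.pos, hl, by linarith, ?_⟩
  rcases hp.level_cases with h4 | h4
  · rw [h.level_eq_two hp h4]; linarith
  · rw [h.level_eq hp h4]; linarith

end Children

/-- Termination and the size of the recursion tree, if at most `K` steps in a row keep a number of
sign variations that is at least two. -/
theorem exists_recursionTree {A B K : ℕ} {f : ℤ[X]}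
    (hwidth : ∀ p : Active, 0 < p.width → 2 ≤ p.var f → -(B : ℝ) ≤ p.logWidth)
    (hpath : ∀ (v : ℕ) (p q : Active) (k s : ℕ), 2 ≤ v → p.var f = v → q.var f = v →
      Path A B (Fails f v) q k s p → s ≤ K)
    (v : ℕ) (p : Active) (hv : p.var f = v) (hp : 2 ≤ v → Valid A B p) :
    ∃ T, IsRecursionTree f p T ∧ T.size ≤ max 1 ((2 * K + 1) * (2 * v - 1)) := by
  induction v using Nat.strong_induction_on generalizing p with
  | _ v ih =>
  rcases Nat.lt_or_ge v 2 with hv2 | hv2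
  · exact ⟨.leaf p, .leaf p (children_of_var_le_one (by omega)), le_max_left _ _⟩
  obtain ⟨w, rfl⟩ : ∃ w, v = w + 2 := ⟨v - 2, by omega⟩
  -- Two positive counts give (2v₁ - 1) + (2v₂ - 1) ≤ 2v - 2. A child of count 0 costs one node,
  -- absorbed because the other count is less than v.
  have hsum : ∀ v₁ v₂, v₁ < w + 2 → v₂ < w + 2 → v₁ + v₂ ≤ w + 2 →
      max 1 ((2 * K + 1) * (2 * v₁ - 1)) + max 1 ((2 * K + 1) * (2 * v₂ - 1)) ≤
        (2 * K + 1) * (2 * (w + 2) - 2) := by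
    have hS : ∀ v, 1 ≤ v → max 1 ((2 * K + 1) * (2 * v - 1)) = (2 * K + 1) * (2 * v - 1) := by
      intro v hv
      apply max_eq_right
      exact Nat.mul_pos (by omega) (by omega)
    intro v₁ v₂ h1 h2 h3
    rcases Nat.eq_zero_or_pos v₁ with rfl | hv1 <;> rcases Nat.eq_zero_or_pos v₂ with rfl | hv2'
    · have : 1 * 2 ≤ (2 * K + 1) * (2 * (w + 2) - 2) := Nat.mul_le_mul (by omega) (by omega)
      simpa using this
    · rw [hS v₂ hv2']
      have : (2 * K + 1) * (2 * v₂ - 1 + 1) ≤ (2 * K + 1) * (2 * (w + 2) - 2) :=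
        Nat.mul_le_mul le_rfl (by omega)
      rw [Nat.mul_add] at this
      have h0 : max 1 ((2 * K + 1) * (2 * 0 - 1)) = 1 := by simp
      omega
    · rw [hS v₁ hv1]
      have : (2 * K + 1) * (2 * v₁ - 1 + 1) ≤ (2 * K + 1) * (2 * (w + 2) - 2) :=
        Nat.mul_le_mul le_rfl (by omega)
      rw [Nat.mul_add] at this
      have h0 : max 1 ((2 * K + 1) * (2 * 0 - 1)) = 1 := by simp
      omega
    · rw [hS v₁ hv1, hS v₂ hv2', ← Nat.mul_add]
      exact Nat.mul_le_mul le_rfl (by omega)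
  set S := (2 * K + 1) * (2 * (w + 2) - 2) with hSdef
  -- i is the number of steps that may still keep the count. Each costs at most two nodes, since by
  -- subadditivity the sibling of a child with full count has count 0 and is a leaf.
  have chain : ∀ (i : ℕ) (q : Active) (k s : ℕ), i + s = K → q.var f = w + 2 →
      Path A B (Fails f (w + 2)) q k s p →
      ∃ T, IsRecursionTree f q T ∧ T.size ≤ 2 * i + 1 + S := by
    intro i
    induction i with
    | zero =>
      intro q k s his hq hpq
      have hqv := hpq.valid_end
      rcases children_cases hqv.four_le hqv.pos hq (by omega) with
        ⟨q', hc, hq', hs⟩ | ⟨hc, hF⟩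
      · have := hpath _ p q' k (s + 1) (by omega) hv hq'
          (hpq.snoc_shrink hs (hs.valid hqv (hwidth q' hs.pos (by omega))))
        omega
      · have hl := halves_leftHalf hqv.pos
        have hr := halves_rightHalf hqv.pos
        have hadd : q.leftHalf.var f + q.rightHalf.var f ≤ q.var f :=
          var_add_var_le f (by have := hl.pos; rw [Active.width] at this; exact sub_pos.1 this)
            (by have := hr.pos; rw [Active.width] at this; exact sub_pos.1 this)
        have hne : ∀ q', Halves q q' → q'.var f ≠ w + 2 := by
          intro q' hs hq'
          have := hpath _ p q' (k + 1) (s + 1) (by omega) hv hq'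
            (hpq.snoc_halve hs hF (hs.valid hqv (hwidth q' hs.pos (by omega))))
          omega
        have hne1 := hne _ hl
        have hne2 := hne _ hr
        obtain ⟨T₁, hT₁, hs₁⟩ := ih (q.leftHalf.var f) (by omega) q.leftHalf rfl
          (fun h => hl.valid hqv (hwidth _ hl.pos h))
        obtain ⟨T₂, hT₂, hs₂⟩ := ih (q.rightHalf.var f) (by omega) q.rightHalf rfl
          (fun h => hr.valid hqv (hwidth _ hr.pos h))
        refine ⟨.split q T₁ T₂, .split q _ _ T₁ T₂ hc hT₁ hT₂, ?_⟩
        have := hsum _ _ (by omega) (by omega) (hadd.trans hq.le)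
        simp only [Tree.size]
        omega
    | succ i ihi =>
      intro q k s his hq hpq
      have hqv := hpq.valid_end
      rcases children_cases hqv.four_le hqv.pos hq (by omega) with
        ⟨q', hc, hq', hs⟩ | ⟨hc, hF⟩
      · obtain ⟨T, hT, hsz⟩ := ihi q' k (s + 1) (by omega) hq'
          (hpq.snoc_shrink hs (hs.valid hqv (hwidth q' hs.pos (by omega))))
        refine ⟨.keep q T, .keep q q' T hc hT, ?_⟩
        simp only [Tree.size]
        omega
      · have hl := halves_leftHalf hqv.pos
        have hr := halves_rightHalf hqv.pos
        have hadd : q.leftHalf.var f + q.rightHalf.var f ≤ q.var f :=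
          var_add_var_le f (by have := hl.pos; rw [Active.width] at this; exact sub_pos.1 this)
            (by have := hr.pos; rw [Active.width] at this; exact sub_pos.1 this)
        by_cases h1 : q.leftHalf.var f = w + 2
        · obtain ⟨T, hT, hsz⟩ := ihi q.leftHalf (k + 1) (s + 1) (by omega) h1
            (hpq.snoc_halve hl hF (hl.valid hqv (hwidth _ hl.pos (by omega))))
          refine ⟨.split q T (.leaf q.rightHalf), .split q _ _ _ _ hc hT
            (.leaf _ (children_of_var_le_one (by omega))), ?_⟩
          simp only [Tree.size]
          omega
        by_cases h2 : q.rightHalf.var f = w + 2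
        · obtain ⟨T, hT, hsz⟩ := ihi q.rightHalf (k + 1) (s + 1) (by omega) h2
            (hpq.snoc_halve hr hF (hr.valid hqv (hwidth _ hr.pos (by omega))))
          refine ⟨.split q (.leaf q.leftHalf) T, .split q _ _ _ _ hc
            (.leaf _ (children_of_var_le_one (by omega))) hT, ?_⟩
          simp only [Tree.size]
          omega
        obtain ⟨T₁, hT₁, hs₁⟩ := ih (q.leftHalf.var f) (by omega) q.leftHalf rfl
          (fun h => hl.valid hqv (hwidth _ hl.pos h))
        obtain ⟨T₂, hT₂, hs₂⟩ := ih (q.rightHalf.var f) (by omega) q.rightHalf rfl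
          (fun h => hr.valid hqv (hwidth _ hr.pos h))
        refine ⟨.split q T₁ T₂, .split q _ _ T₁ T₂ hc hT₁ hT₂, ?_⟩
        have := hsum _ _ (by omega) (by omega) (hadd.trans hq.le)
        simp only [Tree.size]
        omega
  obtain ⟨T, hT, hsz⟩ := chain K p 0 0 (by omega) hv (.refl (hp hv2))
  refine ⟨T, hT, hsz.trans ((Nat.le_of_eq ?_).trans (le_max_right _ _))⟩
  rw [hSdef, show 2 * (w + 2) - 1 = (2 * (w + 2) - 2) + 1 by omega, Nat.mul_add]
  ring

/-! ### Explicit bounds. -/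

theorem neg_le_logWidth {f : ℤ[X]} {τ : ℕ} (hf : Squarefree (f.map (Int.castRingHom ℚ)))
    (hn : 1 ≤ f.natDegree) (hτ : ∀ i, |f.coeff i| < 2 ^ τ) (hτ1 : 1 ≤ τ) {p : Active}
    (hp : 0 < p.width) (hv : 2 ≤ p.var f) :
    -((5 * f.natDegree ^ 2 * τ + f.natDegree + 3 : ℕ) : ℝ) ≤ p.logWidth := by
  have hab : p.a < p.b := by rw [Active.width] at hp; linarith
  have h := width_lower_bound hf hn hτ hτ1 hab hv
  have e : (p.width : ℝ) = p.b - p.a := by rw [Active.width]; push_cast; rfl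
  have hp' : (0 : ℝ) < p.width := by exact_mod_cast hp
  set E := 5 * f.natDegree ^ 2 * τ + f.natDegree + 3
  rw [← e] at h
  have h2 := Real.logb_nonneg (b := 2) (by norm_num) h
  rw [Real.logb_mul hp'.ne' (by positivity), Real.logb_pow, Real.logb_self_eq_one (by norm_num),
    mul_one] at h2
  rw [Active.logWidth]; linarith

theorem valid_initial (τ B : ℕ) : Valid (τ + 2) B (initial τ) := by
  have e : (initial τ).width = 2 ^ (τ + 2) := by
    simp only [initial, Active.width]; ring
  have hl : (initial τ).logWidth = (τ + 2 : ℕ) := by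
    rw [Active.logWidth, e]
    push_cast
    rw [Real.logb_pow, Real.logb_self_eq_one (by norm_num)]
    push_cast; ring
  have h0 : (0 : ℝ) ≤ τ := by positivity
  have hB : (0 : ℝ) ≤ B := by positivity
  refine ⟨⟨0, rfl⟩, by rw [e]; positivity, ?_, hl.le, ?_⟩
  · rw [hl]; push_cast; linarith
  · rw [level_of_form (m := 0) rfl]; push_cast; linarith

/-- With t = 6e + 15 (from (4/3)³ ≥ 2), J = 2e + 11 and c = e + 10 there are at most 27e + 86
bisections; M = 2e + 4 then gives the bound on all steps. -/
theorem path_length_le {f : ℤ[X]} {τ e : ℕ} (hf : Squarefree (f.map (Int.castRingHom ℚ)))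
    (h2 : 2 ≤ f.natDegree * τ) (he : f.natDegree * τ ≤ 2 ^ e) {v : ℕ} (hv : 1 ≤ v)
    {p q : Active} {k s : ℕ} (hp : p.var f = v) (hq : q.var f = v)
    (h : Path (τ + 2) (5 * f.natDegree ^ 2 * τ + f.natDegree + 3) (Fails f v) q k s p) :
    s ≤ 56 * e + 176 := by
  set n := f.natDegree
  have hn : 1 ≤ n := Nat.pos_of_ne_zero (by rintro h; simp [h] at h2)
  have hτ : 1 ≤ τ := Nat.pos_of_ne_zero (by rintro h; simp [h] at h2)
  have hnP : n ≤ 2 ^ e := le_trans (Nat.le_mul_of_pos_right n hτ) he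
  have hτP : τ ≤ 2 ^ e := le_trans (Nat.le_mul_of_pos_left τ hn) he
  have hP : 2 ≤ 2 ^ e := h2.trans he
  have hsq : n ^ 2 * τ ≤ 2 ^ e * 2 ^ e := by
    calc n ^ 2 * τ = n * (n * τ) := by ring
      _ ≤ 2 ^ e * 2 ^ e := Nat.mul_le_mul hnP he
  have hPP : 2 * 2 ^ e ≤ 2 ^ e * 2 ^ e := Nat.mul_le_mul hP le_rfl
  have hAB : (τ + 2) + (5 * n ^ 2 * τ + n + 3) ≤ 2 ^ (2 * e + 3) := by
    have e1 : 2 ^ (2 * e + 3) = 8 * (2 ^ e * 2 ^ e) := by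
      rw [pow_add, two_mul, pow_add]; ring
    have e2 : 5 * n ^ 2 * τ = 5 * (n ^ 2 * τ) := by ring
    rw [e1, e2]
    omega
  have ht : 3 * (((τ + 2 : ℕ) : ℝ) + ((5 * n ^ 2 * τ + n + 3 : ℕ) : ℝ)) ≤
      (4 / 3) ^ (3 * (2 * e + 5)) := by
    have h1 : ((τ + 2 : ℕ) : ℝ) + ((5 * n ^ 2 * τ + n + 3 : ℕ) : ℝ) ≤ 2 ^ (2 * e + 3) := by
      exact_mod_cast hAB
    calc _ ≤ 4 * (2 : ℝ) ^ (2 * e + 3) := by linarith [pow_pos (two_pos (α := ℝ)) (2 * e + 3)]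
      _ = 2 ^ (2 * e + 5) := by rw [pow_add, pow_add]; ring
      _ ≤ ((4 / 3) ^ 3) ^ (2 * e + 5) := by gcongr; norm_num
      _ = _ := by rw [← pow_mul]
  have hJ : 512 * (n * (n + 2)) ≤ 2 ^ (2 * e + 11) := by
    have e1 : 2 ^ (2 * e + 11) = 2048 * (2 ^ e * 2 ^ e) := by
      rw [pow_add, two_mul, pow_add]; ring
    have e2 : n * (n + 2) ≤ 2 ^ e * (4 * 2 ^ e) := Nat.mul_le_mul hnP (by omega)
    rw [e1]
    nlinarith
  have hc : 256 * (n + 2) ≤ 2 ^ (e + 10) := by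
    rw [pow_add]; omega
  have hk := fails_le_of_path hf hn hv hq ht hJ hc hp h
  have hs := h.length_le_fails (M := 2 * e + 4) (by
    have : 2 ^ (2 * e + 4) = 2 * 2 ^ (2 * e + 3) := by ring
    omega)
  omega

/-- ⌈log₂ P⌉ ≤ log₂ P + 1 ≤ 2 log₂ P. -/
theorem clog_le_log {P : ℕ} (hP : 2 ≤ P) :
    1 ≤ Nat.clog 2 P ∧ (Nat.clog 2 P : ℝ) ≤ 2 / Real.log 2 * Real.log P := by
  have h1 : 1 ≤ Nat.clog 2 P := Nat.clog_pos (by norm_num) hP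
  refine ⟨h1, ?_⟩
  have hl2 : 0 < Real.log 2 := Real.log_pos (by norm_num)
  have h2 : 2 ^ (Nat.clog 2 P - 1) < P := Nat.pow_pred_clog_lt_self (by norm_num) (by omega)
  have h3 : (2 : ℝ) ^ (Nat.clog 2 P - 1) ≤ P := by exact_mod_cast h2.le
  have h4 : ((Nat.clog 2 P - 1 : ℕ) : ℝ) * Real.log 2 ≤ Real.log P := by
    rw [← Real.log_pow]
    exact Real.log_le_log (by positivity) h3
  have h5 : Real.log 2 ≤ Real.log P := Real.log_le_log (by norm_num) (by exact_mod_cast hP)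
  rw [Nat.cast_sub h1] at h4
  rw [div_mul_eq_mul_div, le_div_iff₀ hl2]
  push_cast at h4
  linarith

end DscSq

theorem mainTheorem2 :
    ∃ C : ℝ, 0 < C ∧
      ∀ (n τ : ℕ) (f : Polynomial ℤ),
        f.natDegree = n →
        Squarefree (f.map (Int.castRingHom ℚ)) →
        (∀ i, |f.coeff i| < 2 ^ τ) →
        2 ≤ n * τ →
        ∃ T : DscSq.Tree, DscSq.IsRecursionTree f (DscSq.initial τ) T ∧
          (T.size : ℝ) ≤ C * (max 1 ((DscSq.initial τ).var f) : ℕ) * (Real.log n + Real.log τ) ∧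
          (T.size : ℝ) ≤ C * n * (Real.log n + Real.log τ) := by
  have hl2 : 0 < Real.log 2 := Real.log_pos (by norm_num)
  -- For e ≥ 1, 56e + 176 ≤ 232e and 2 · 232e + 1 ≤ 465e; the factor 2v - 1 ≤ 2m doubles 465 to 930.
  refine ⟨930 * (2 / Real.log 2), by positivity, ?_⟩
  rintro n τ f rfl hf hτ h2
  have hn : 1 ≤ f.natDegree := Nat.pos_of_ne_zero (by rintro h; simp [h] at h2)
  have hτ1 : 1 ≤ τ := Nat.pos_of_ne_zero (by rintro h; simp [h] at h2)
  set e := Nat.clog 2 (f.natDegree * τ) with he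
  obtain ⟨he1, hlog⟩ := DscSq.clog_le_log h2
  rw [← he] at he1 hlog
  obtain ⟨T, hT, hsz⟩ := DscSq.exists_recursionTree (K := 232 * e)
    (fun p hp hv => DscSq.neg_le_logWidth hf hn hτ hτ1 hp hv)
    (fun v p q k s hv hp hq h => by
      have := DscSq.path_length_le hf h2 (Nat.le_pow_clog (by norm_num) _) (by omega) hp hq h
      rw [← he] at this
      omega)
    ((DscSq.initial τ).var f) (DscSq.initial τ) rfl (fun _ => DscSq.valid_initial τ _)
  have hlogmul : Real.log f.natDegree + Real.log τ = Real.log ((f.natDegree * τ : ℕ) : ℝ) := by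
    push_cast
    rw [Real.log_mul (by positivity) (by positivity)]
  have key : (T.size : ℝ) ≤ 930 * (2 / Real.log 2) *
      (max 1 ((DscSq.initial τ).var f) : ℕ) * (Real.log f.natDegree + Real.log τ) := by
    set m := max 1 ((DscSq.initial τ).var f) with hm
    have h1 : T.size ≤ 930 * m * e := by
      refine hsz.trans (max_le ?_ ?_)
      · have : 1 * 1 ≤ m * e := Nat.mul_le_mul (le_max_left _ _) he1
        nlinarith
      · have h3 : (DscSq.initial τ).var f ≤ m := le_max_right _ _
        calc (2 * (232 * e) + 1) * (2 * (DscSq.initial τ).var f - 1) ≤ (465 * e) * (2 * m) :=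
              Nat.mul_le_mul (by omega) (by omega)
          _ = 930 * m * e := by ring
    have h3 : (T.size : ℝ) ≤ 930 * m * e := by exact_mod_cast h1
    rw [hlogmul]
    calc (T.size : ℝ) ≤ 930 * m * e := h3
      _ ≤ 930 * m * (2 / Real.log 2 * Real.log ((f.natDegree * τ : ℕ) : ℝ)) := by gcongr
      _ = _ := by ring
  refine ⟨T, hT, key, key.trans ?_⟩
  have hlog0 : 0 ≤ Real.log f.natDegree + Real.log τ := by
    rw [hlogmul]; exact Real.log_natCast_nonneg _
  gcongr
  exact max_le hn (DscSq.var_le_natDegree _ _)
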